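/- Let $\mathcal X,\mathcal Y$ be Polish spaces with their Borel $\sigma$-algebras, let $\mathcal H$ be a (possibly infinite) set of measurable maps $h:\mathcal X\to\mathcal Y$, and let $l((x,y),h)=\mathbb I[y\neq h(x)]$ be the zero-one loss. Assume, as is usual in empirical process theory, that $(z_1,\dots,z_m)\mapsto\sup_{h\in\mathcal H}\sum_{i=1}^m a_i\,l(z_i,h)$ is measurable on $(\mathcal X\times\mathcal Y)^m$ for all $m\in\mathbb N$ and $a\in\mathbb R^m$. For a probability measure $P$ on $\mathcal X\times\mathcal Y$ put $L_P(h)=\int l(z,h)\,P(dz)$. Let $\mathcal P$ be a credal set on $\mathcal X\times\mathcal Y$, i.e. a convex set of Borel probability measures that is closed in the topology of weak convergence, and let $\mathrm{ex}\,\mathcal P$ be its set of extreme elements. Let $P\in\mathcal P$, $n\ge 1$, let $(x_1,y_1),\dots,(x_n,y_n)\sim P$ be i.i.d. random elements on a probability space with probability $\mathbb P$, let $\hat h\in\arg\min_{h\in\mathcal H}\frac1n\sum_{i=1}^n l((x_i,y_i),h)$ be an empirical risk minimizer, and suppose $h^\star\in\arg\min_{h\in\mathcal H}L_P(h)$ (both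 minima are assumed to be attained). Let $\delta\in(0,1)$ and $$\epsilon^{\star\star\star}(\delta)=4\sup_{E\in\mathrm{ex}\,\mathcal P}R_{n,E}+\sqrt{\frac{2\log(2/\delta)}{n}},\qquad R_{n,E}=\mathbb E\Big[\sup_{h\in\mathcal H}\frac1n\sum_{i=1}^n\sigma_i\,l(z_i,h)\Big],$$ where $z_1,\dots,z_n\sim E$ are i.i.d. and $\sigma_1,\dots,\sigma_n$ are i.i.d. uniform on $\{-1,1\}$, independent of the $z_i$. Let $\eta>0$ and suppose that the total variation diameter of $\mathcal P$, $\mathrm{diam}_{TV}(\mathcal P)=\sup_{P',P''\in\mathcal P}\sup_A|P'(A)-P''(A)|$ (with $A$ ranging over the Borel sets), equals $\eta$. Then for every $Q\in\mathcal P$ with $Q\neq P$, $$\mathbb P\big[L_Q(\hat h)-L_P(h^\star)\le\epsilon^{\star\star\star}(\delta)+\eta\big]\ge 1-\delta ,$$ in the sense that the event in brackets contains a measurable set of probability at least $1-\delta$. -/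

import Mathlib

open MeasureTheory ProbabilityTheory
open scoped NNReal ENNReal

noncomputable section

namespace CredalLearning

variable {X Y : Type*}

open Classical in
/-- The zero-one loss `l((x, y), h) = 𝟙[y ≠ h(x)]`. -/
def loss (z : X × Y) (h : X → Y) : ℝ := if z.2 ≠ h z.1 then 1 else 0

/-- The empirical risk of `h` on the sample `z₁, …, zₙ`. -/
def empRisk {n : ℕ} (z : Fin n → X × Y) (h : X → Y) : ℝ :=
  (1 / (n : ℝ)) * ∑ i, loss (z i) h

/-- The hypothesis `h` minimizes the empirical risk over `H` on the sample `z₁, …, zₙ`. -/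
def IsERM {n : ℕ} (H : Set (X → Y)) (z : Fin n → X × Y) (h : X → Y) : Prop :=
  h ∈ H ∧ ∀ g ∈ H, empRisk z h ≤ empRisk z g

variable [MeasurableSpace X] [MeasurableSpace Y]

/-- The expected risk `L_P(h) = 𝔼_P[l((x, y), h)]`. -/
def risk (P : ProbabilityMeasure (X × Y)) (h : X → Y) : ℝ :=
  ∫ z, loss z h ∂(P : Measure (X × Y))

/-- The hypothesis `h` minimizes the expected risk `L_P` over `H`. -/
def IsRiskMin (H : Set (X → Y)) (P : ProbabilityMeasure (X × Y)) (h : X → Y) : Prop :=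
  h ∈ H ∧ ∀ g ∈ H, risk P h ≤ risk P g

/-- The loss class `{l(·, h) : h ∈ H}` is measurable in the usual sense of empirical process
theory: for every finite weight vector, the weighted suprema over the class are measurable
functions of the sample. -/
def IsMeasurableClass (H : Set (X → Y)) : Prop :=
  ∀ (m : ℕ) (a : Fin m → ℝ),
    Measurable fun z : Fin m → X × Y => ⨆ h : H, ∑ i, a i * loss (z i) h

/-- The Rademacher complexity of the loss class under `P`: the expectation of
`sup_{h ∈ H} (1/n) ∑ᵢ σᵢ l(zᵢ, h)`, where `z₁, …, zₙ` are i.i.d. from `P` and, independently of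
them, the signs `σ₁, …, σₙ` are i.i.d. uniform on `{-1, 1}` (here the units of `ℤ`). -/
def rademacher (n : ℕ) (H : Set (X → Y)) (P : ProbabilityMeasure (X × Y)) : ℝ :=
  (1 / (2 : ℝ) ^ n) * ∑ σ : Fin n → ℤˣ,
    ∫ z : Fin n → X × Y, (⨆ h : H, (1 / (n : ℝ)) * ∑ i, ((σ i : ℤ) : ℝ) * loss (z i) h)
      ∂(Measure.pi fun _ => (P : Measure (X × Y)))

variable {Ω : Type*} [MeasurableSpace Ω]

/-- A set of probability measures, seen inside the `ℝ≥0`-module of all measures. -/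
def asMeasures (C : Set (ProbabilityMeasure Ω)) : Set (Measure Ω) :=
  (fun P : ProbabilityMeasure Ω => (P : Measure Ω)) '' C

/-- A credal set: a convex set of Borel probability measures that is closed in the topology of
weak convergence (the topology that `ProbabilityMeasure Ω` carries). -/
structure IsCredalSet [TopologicalSpace Ω] [OpensMeasurableSpace Ω]
    (C : Set (ProbabilityMeasure Ω)) : Prop where
  convex : Convex ℝ≥0 (asMeasures C)
  closed : IsClosed C

/-- The extreme elements of a set of probability measures. -/
def extremeElements (C : Set (ProbabilityMeasure Ω)) : Set (ProbabilityMeasure Ω) :=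
  {P | (P : Measure Ω) ∈ Set.extremePoints ℝ≥0 (asMeasures C)}

/-- The total variation distance `sup_A |P(A) - Q(A)|`, over the measurable sets `A`. -/
def tvDist (P Q : ProbabilityMeasure Ω) : ℝ :=
  ⨆ A : {A : Set Ω // MeasurableSet A},
    |(P : Measure Ω).real A.1 - (Q : Measure Ω).real A.1|

/-- The total variation diameter of a set of probability measures. -/
def tvDiam (C : Set (ProbabilityMeasure Ω)) : ℝ :=
  ⨆ p : C × C, tvDist p.1.1 p.2.1

/-- The supremum of the Rademacher complexities over the extreme elements of `C`. -/
def upperRademacher (n : ℕ) (H : Set (X → Y)) (C : Set (ProbabilityMeasure (X × Y))) : ℝ :=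
  ⨆ E : extremeElements C, rademacher n H E.1

/-- The bound `4 sup_E R_{n,E} + √(2 log(2/δ) / n)`. -/
def epsBound (n : ℕ) (H : Set (X → Y)) (C : Set (ProbabilityMeasure (X × Y))) (δ : ℝ) : ℝ :=
  4 * upperRademacher n H C + √(2 * Real.log (2 / δ) / n)

end CredalLearning

end

/-! The complexity under P involves n-fold products of P, so writing P as a mixture of extreme
elements gives no direct bound on it. Instead, the slack η pays for replacing P by a part of it that
lies below extreme elements. By `exists_extreme_overlap` there are extreme E, E' and densities g, g'
≥ 0 with g + g' ≤ 1, gP ≤ E, g'P ≤ E', (g + g')P ≤ Q and ∫ (g + g') dP ≥ 1 - η.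

These come from Choquet's theorem (`exists_mixture_extremeElements`): P and Q are mixtures of
extreme elements, and two extreme elements overlap in mass at least 1 - η. Take a Hahn set B with Q
≤ P on B and P ≤ Q off B. Overlap is concave in each argument, so averaging out one partner on B and
the other one off B (`exists_overlap_of_mixture`) leaves an E overlapping Q on B and an E'
overlapping P off B, with total mass at least 1 - η. Both pieces lie below P and below Q.

Since the loss is at most 1, L_Q(h) ≤ η + ∫ (g + g') l(·, h) dP (`risk_le_of_overlap`). A ghost
sample compares this weighted risk with the empirical risk, where the weights can be dropped, and
minimality replaces ĥ by h⋆. What remains is one function of the sample with differences bounded by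
2/n, so McDiarmid's inequality controls its deviation. Its mean is at most L_P(h⋆) plus, by
symmetrization, twice the weighted complexities for g and for g'. Convexity of the supremum in the
weights and gP ≤ E bound these by R_{n,E} and R_{n,E'}, one coordinate at a time
(`integral_signAverage_le`), whence the factor 4 = 2 + 2. -/

noncomputable section

namespace CredalLearning

/-! ### Upper envelopes and representing measures on a compact space -/

section Choquet

variable {K : Type*} [TopologicalSpace K]

/-- The value at `x` of the upper envelope of `g`: the infimum of `h x` over the majorants `h` of
`g` in the subspace `A`. -/
def upperEnvelope (A : Submodule ℝ C(K, ℝ)) (x : K) (g : C(K, ℝ)) : ℝ :=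
  sInf ((fun h : C(K, ℝ) => h x) '' {h | h ∈ A ∧ ∀ z, g z ≤ h z})

lemma upperEnvelope_le {A : Submodule ℝ C(K, ℝ)} {x : K} {g h : C(K, ℝ)} (hA : h ∈ A)
    (hg : ∀ z, g z ≤ h z) : upperEnvelope A x g ≤ h x := by
  refine csInf_le ⟨g x, ?_⟩ ⟨h, ⟨hA, hg⟩, rfl⟩
  rintro _ ⟨h', ⟨-, h'g⟩, rfl⟩
  exact h'g x

variable [CompactSpace K]

lemma majorants_nonempty {A : Submodule ℝ C(K, ℝ)} (h1 : (1 : C(K, ℝ)) ∈ A) (g : C(K, ℝ)) :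
    {h | h ∈ A ∧ ∀ z, g z ≤ h z}.Nonempty := by
  refine ⟨‖g‖ • (1 : C(K, ℝ)), A.smul_mem _ h1, fun z => ?_⟩
  simpa using (le_abs_self _).trans (g.norm_coe_le_norm z)

lemma le_upperEnvelope {A : Submodule ℝ C(K, ℝ)} (h1 : (1 : C(K, ℝ)) ∈ A) {x : K} {g : C(K, ℝ)}
    {r : ℝ} (hr : ∀ h ∈ A, (∀ z, g z ≤ h z) → r ≤ h x) : r ≤ upperEnvelope A x g := by
  refine le_csInf ((majorants_nonempty h1 g).image _) ?_
  rintro _ ⟨h, ⟨hA, hg⟩, rfl⟩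
  exact hr h hA hg

lemma upperEnvelope_add {A : Submodule ℝ C(K, ℝ)} (h1 : (1 : C(K, ℝ)) ∈ A) (x : K)
    (f g : C(K, ℝ)) :
    upperEnvelope A x (f + g) ≤ upperEnvelope A x f + upperEnvelope A x g := by
  rw [← sub_le_iff_le_add]
  refine le_upperEnvelope h1 fun h hA hf => ?_
  rw [sub_le_comm]
  refine le_upperEnvelope h1 fun h' hA' hg => ?_
  rw [sub_le_iff_le_add']
  exact upperEnvelope_le (g := f + g) (h := h + h') (A.add_mem hA hA')
    fun z => add_le_add (hf z) (hg z)

lemma upperEnvelope_smul {A : Submodule ℝ C(K, ℝ)} (h1 : (1 : C(K, ℝ)) ∈ A) (x : K)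
    {c : ℝ} (hc : 0 < c) (g : C(K, ℝ)) :
    upperEnvelope A x (c • g) = c * upperEnvelope A x g := by
  have key : ∀ (c : ℝ), 0 < c → ∀ g : C(K, ℝ),
      upperEnvelope A x (c • g) ≤ c * upperEnvelope A x g := by
    intro c hc g
    rw [← div_le_iff₀' hc]
    refine le_upperEnvelope h1 fun h hA hg => ?_
    rw [div_le_iff₀' hc]
    exact upperEnvelope_le (h := c • h) (A.smul_mem _ hA)
      fun z => mul_le_mul_of_nonneg_left (hg z) hc.le
  refine le_antisymm (key c hc g) ?_
  have := key c⁻¹ (inv_pos.2 hc) (c • g)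
  rw [smul_smul, inv_mul_cancel₀ hc.ne', one_smul] at this
  rwa [← le_inv_mul_iff₀ hc]

/-- Hahn–Banach: the envelope at x is sublinear and dominates its linear extension from f to the
line through f; for negative multiples this is subadditivity at c • f and its negative. Equality at
f later forces the representing measure to live where f touches its envelope. -/
lemma exists_linear_le_upperEnvelope {A : Submodule ℝ C(K, ℝ)} (h1 : (1 : C(K, ℝ)) ∈ A) (x : K)
    (f : C(K, ℝ)) :
    ∃ L : C(K, ℝ) →ₗ[ℝ] ℝ, L f = upperEnvelope A x f ∧ ∀ g, L g ≤ upperEnvelope A x g := by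
  have h0 : upperEnvelope A x 0 = 0 := by
    have := upperEnvelope_smul h1 x (c := 2) (by norm_num) 0
    rw [smul_zero] at this
    linarith
  have H : ∀ c : ℝ, c • f = 0 → c • upperEnvelope A x f = 0 := by
    intro c hcf
    rcases smul_eq_zero.1 hcf with rfl | rfl
    · simp
    · simp [h0]
  obtain ⟨L, hL, hLp⟩ := exists_extension_of_le_sublinear
    (LinearPMap.mkSpanSingleton' f (upperEnvelope A x f) H) (upperEnvelope A x)
    (fun c hc g => upperEnvelope_smul h1 x hc g) (upperEnvelope_add h1 x) (by
      rintro ⟨g, hg⟩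
      obtain ⟨c, rfl⟩ := Submodule.mem_span_singleton.1 hg
      rw [LinearPMap.mkSpanSingleton'_apply]
      rcases lt_trichotomy c 0 with hc | rfl | hc
      · have e : upperEnvelope A x (-(c • f)) = -c * upperEnvelope A x f := by
          rw [← neg_smul]
          exact upperEnvelope_smul h1 x (neg_pos.2 hc) f
        have := upperEnvelope_add h1 x (c • f) (-(c • f))
        rw [add_neg_cancel, h0, e] at this
        simp only [smul_eq_mul, RingHom.id_apply]
        linarith
      · simp [h0]
      · simp [upperEnvelope_smul h1 x hc f])
  refine ⟨L, ?_, hLp⟩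
  have := hL ⟨f, Submodule.mem_span_singleton_self f⟩
  rw [this]
  exact LinearPMap.mkSpanSingleton'_apply_self _ _ _ _

lemma exists_measure_of_positive [T2Space K] [MeasurableSpace K] [BorelSpace K]
    (L : C(K, ℝ) →ₗ[ℝ] ℝ) (hL : ∀ g : C(K, ℝ), (∀ z, 0 ≤ g z) → 0 ≤ L g) :
    ∃ π : Measure K, IsFiniteMeasure π ∧ ∀ g : C(K, ℝ), ∫ z, g z ∂π = L g := by
  let Λ : CompactlySupportedContinuousMap K ℝ →ₚ[ℝ] ℝ :=
    { toFun g := L g.toContinuousMap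
      map_add' g g' := L.map_add _ _
      map_smul' c g := L.map_smul _ _
      monotone' g g' hgg' := by
        have := hL (g'.toContinuousMap - g.toContinuousMap) fun z => sub_nonneg.2 (hgg' z)
        rw [map_sub] at this
        exact sub_nonneg.1 this }
  refine ⟨RealRMK.rieszMeasure Λ, inferInstance, fun g => ?_⟩
  exact RealRMK.integral_rieszMeasure Λ
    { toContinuousMap := g, hasCompactSupport' := HasCompactSupport.of_compactSpace _ }

/-- The core of Choquet's theorem: a point `x` of a compact space is represented by a probability
measure on which `f` coincides almost everywhere with its upper envelope over `A`. -/
theorem exists_representing_measure [T2Space K] [MeasurableSpace K] [BorelSpace K]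
    (A : Submodule ℝ C(K, ℝ)) (h1 : (1 : C(K, ℝ)) ∈ A) (f : C(K, ℝ)) (x : K) :
    ∃ π : Measure K, IsProbabilityMeasure π ∧ (∀ h ∈ A, ∫ z, h z ∂π = h x) ∧
      ∀ᵐ y ∂π, ∀ ε > 0, ∃ h ∈ A, (∀ z, f z ≤ h z) ∧ h y < f y + ε := by
  obtain ⟨L, hLf, hLp⟩ := exists_linear_le_upperEnvelope h1 x f
  have hLA : ∀ h ∈ A, L h = h x := by
    intro h hA
    have a := (hLp h).trans (upperEnvelope_le hA fun _ => le_rfl)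
    have b := (hLp (-h)).trans (upperEnvelope_le (A.neg_mem hA) fun _ => le_rfl)
    rw [map_neg, ContinuousMap.neg_apply] at b
    exact le_antisymm a (neg_le_neg_iff.1 b)
  -- Positivity: if g ≥ 0, then 0 is a majorant of -g in `A`, so L(-g) ≤ 0.
  obtain ⟨π, hπ, hπL⟩ := exists_measure_of_positive L fun g hg => by
    have b := (hLp (-g)).trans (upperEnvelope_le (h := 0) A.zero_mem
      fun z => by simpa using hg z)
    simpa using b
  have hprob : IsProbabilityMeasure π := by
    have h := hπL 1
    rw [hLA 1 h1] at h
    simp only [ContinuousMap.one_apply, integral_const, smul_eq_mul, mul_one] at h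
    exact ⟨by rwa [measureReal_def, ENNReal.toReal_eq_one_iff] at h⟩
  have hint : ∀ g : C(K, ℝ), Integrable g π := fun g =>
    Integrable.of_bound g.continuous.aestronglyMeasurable ‖g‖ (ae_of_all _ g.norm_coe_le_norm)
  refine ⟨π, hprob, fun h hA => by rw [hπL, hLA h hA], ?_⟩
  have hbad : ∀ m : ℕ, ∀ᵐ y ∂π, ∃ h ∈ A, (∀ z, f z ≤ h z) ∧ h y < f y + 1 / ((m : ℝ) + 1) := by
    intro m
    have hm : (0 : ℝ) < 1 / ((m : ℝ) + 1) := by positivity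
    have hex : ∀ k : ℕ, ∃ h ∈ A, (∀ z, f z ≤ h z) ∧
        h x < upperEnvelope A x f + 1 / ((k : ℝ) + 1) := by
      intro k
      obtain ⟨_, ⟨h, ⟨hA, hf⟩, rfl⟩, hlt⟩ := exists_lt_of_csInf_lt
        ((majorants_nonempty h1 f).image fun h : C(K, ℝ) => h x)
        (show upperEnvelope A x f < upperEnvelope A x f + 1 / ((k : ℝ) + 1) by
          have : (0 : ℝ) < 1 / ((k : ℝ) + 1) := by positivity
          linarith)
      exact ⟨h, hA, hf, hlt⟩
    choose h hA hf hlt using hex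
    -- Markov's inequality: the integral of h k - f is h k x minus the envelope of f at x, hence at
    -- most 1/(k+1).
    have hmeas : ∀ k, π.real {y | 1 / ((m : ℝ) + 1) ≤ h k y - f y} ≤
        (1 / ((k : ℝ) + 1)) * ((m : ℝ) + 1) := by
      intro k
      have hmk := mul_meas_ge_le_integral_of_nonneg (μ := π) (f := fun y => h k y - f y)
        (ae_of_all _ fun y => sub_nonneg.2 (hf k y)) ((hint _).sub (hint _)) (1 / ((m : ℝ) + 1))
      rw [integral_sub (hint _) (hint _), hπL, hπL, hLA _ (hA k), hLf] at hmk
      rw [one_div_mul_eq_div, div_le_iff₀' (by positivity)] at hmk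
      have : h k x - upperEnvelope A x f ≤ 1 / ((k : ℝ) + 1) := by linarith [hlt k]
      calc _ ≤ _ := hmk
        _ ≤ ((m : ℝ) + 1) * (1 / ((k : ℝ) + 1)) := by gcongr
        _ = _ := mul_comm _ _
    have hzero : π {y | ∀ k, 1 / ((m : ℝ) + 1) ≤ h k y - f y} = 0 := by
      rw [← measureReal_eq_zero_iff]
      refine le_antisymm (ge_of_tendsto' (x := Filter.atTop)
        (f := fun k : ℕ => (1 / ((k : ℝ) + 1)) * ((m : ℝ) + 1)) ?_ fun k => ?_)
        measureReal_nonneg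
      · simpa using (tendsto_one_div_add_atTop_nhds_zero_nat (𝕜 := ℝ)).mul_const ((m : ℝ) + 1)
      · exact (measureReal_mono (Set.ofPred_subset_ofPred.2 fun y hy => hy k)).trans (hmeas k)
    filter_upwards [compl_mem_ae_iff.2 hzero] with y hy
    simp only [Set.mem_compl_iff, Set.mem_ofPred_eq, not_forall, not_le] at hy
    obtain ⟨k, hk⟩ := hy
    exact ⟨h k, hA k, hf k, by linarith⟩
  filter_upwards [ae_all_iff.2 hbad] with y hy ε hε
  obtain ⟨m, hm⟩ := exists_nat_one_div_lt hε
  obtain ⟨h, hA, hf, hlt⟩ := hy m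
  exact ⟨h, hA, hf, by linarith⟩

end Choquet

/-! ### Choquet's theorem for closed sets of probability measures -/

section ChoquetMeasures

/-- Closed sets form a generating π-system, and the measure of a closed set is a limit of integrals
of bounded continuous functions, which depend continuously on y. -/
lemma measurable_toMeasure_of_continuous {W K : Type*} [TopologicalSpace W] [MeasurableSpace W]
    [BorelSpace W] [HasOuterApproxClosed W] [TopologicalSpace K] [MeasurableSpace K] [BorelSpace K]
    {e : K → ProbabilityMeasure W} (he : Continuous e) :
    Measurable fun y => (e y : Measure W) := by
  refine Measurable.measure_of_isPiSystem_of_isProbabilityMeasure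
    (S := {s | IsClosed s}) ?_ isPiSystem_isClosed ?_
  · rw [BorelSpace.measurable_eq (α := W), borel_eq_generateFrom_isClosed]
  · intro F hF
    refine measurable_of_tendsto_metrizable (f := fun n y => ∫⁻ x, (hF.apprSeq n) x ∂(e y : Measure W))
      (fun n => ?_) (tendsto_pi_nhds.2 fun y =>
        HasOuterApproxClosed.tendsto_lintegral_apprSeq hF (e y : Measure W))
    exact ((ProbabilityMeasure.continuous_lintegral_boundedContinuousFunction _).comp he).measurable

lemma continuousMap_integrable {W : Type*} [TopologicalSpace W] [CompactSpace W] [MeasurableSpace W]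
    [BorelSpace W] (φ : C(W, ℝ)) (μ : Measure W) [IsFiniteMeasure μ] : Integrable φ μ :=
  (BoundedContinuousFunction.mkOfCompact φ).integrable μ

lemma continuous_integral_continuousMap_left {W : Type*} [TopologicalSpace W] [CompactSpace W]
    [MeasurableSpace W] [BorelSpace W] (μ : Measure W) [IsProbabilityMeasure μ] :
    Continuous fun φ : C(W, ℝ) => ∫ x, φ x ∂μ := by
  refine LipschitzWith.continuous (K := 1) (LipschitzWith.of_dist_le_mul fun φ ψ => ?_)
  rw [dist_eq_norm, ← integral_sub (continuousMap_integrable φ μ) (continuousMap_integrable ψ μ),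
    dist_eq_norm, NNReal.coe_one, one_mul]
  simpa using norm_integral_le_of_norm_le_const (μ := μ)
    (ae_of_all _ fun x => (φ - ψ).norm_coe_le_norm x)

/-- On the probability measures of a compact metrizable space there is a strictly convex
continuous function. -/
lemma exists_strictConvex {W : Type*} [TopologicalSpace W] [CompactSpace W]
    [TopologicalSpace.MetrizableSpace W] [MeasurableSpace W] [BorelSpace W] :
    ∃ f : C(ProbabilityMeasure W, ℝ), ∀ E E₁ E₂ : ProbabilityMeasure W, ∀ a b : ℝ, 0 < a → 0 < b →
      a + b = 1 →
      (∀ φ : C(W, ℝ), ∫ x, φ x ∂(E : Measure W)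
        = a * ∫ x, φ x ∂(E₁ : Measure W) + b * ∫ x, φ x ∂(E₂ : Measure W)) →
      E₁ ≠ E₂ → f E < a * f E₁ + b * f E₂ := by
  let d : ℕ → C(W, ℝ) := TopologicalSpace.denseSeq C(W, ℝ)
  -- Squares of integrals against a dense sequence, scaled so that the k-th one is at most 4⁻ᵏ. Each
  -- is convex, and some integral separates two given distinct measures.
  let t : ℕ → ProbabilityMeasure W → ℝ := fun k E =>
    ((1 / 2) ^ k * (1 / (1 + ‖d k‖)) * ∫ x, d k x ∂(E : Measure W)) ^ 2
  have htc : ∀ k, Continuous (t k) := fun k =>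
    ((ProbabilityMeasure.continuous_integral_continuousMap (d k)).const_mul _).pow 2
  have htb : ∀ k E, ‖t k E‖ ≤ (1 / 4 : ℝ) ^ k := by
    intro k E
    have h1 : |∫ x, d k x ∂(E : Measure W)| ≤ ‖d k‖ := by
      simpa using norm_integral_le_of_norm_le_const (μ := (E : Measure W))
        (ae_of_all _ fun x => (d k).norm_coe_le_norm x)
    have h2 : |(1 / (1 + ‖d k‖)) * ∫ x, d k x ∂(E : Measure W)| ≤ 1 := by
      rw [abs_mul, abs_of_nonneg (by positivity), one_div_mul_eq_div, div_le_one (by positivity)]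
      linarith
    have h3 : t k E = (1 / 4 : ℝ) ^ k * ((1 / (1 + ‖d k‖)) * ∫ x, d k x ∂(E : Measure W)) ^ 2 := by
      simp only [t]
      rw [mul_assoc, mul_pow, ← pow_mul, mul_comm k 2, pow_mul]
      norm_num
    rw [h3, Real.norm_of_nonneg (by positivity)]
    exact mul_le_of_le_one_right (by positivity) ((sq_le_one_iff_abs_le_one _).2 h2)
  have hsum : Summable fun k => (1 / 4 : ℝ) ^ k :=
    summable_geometric_of_lt_one (by norm_num) (by norm_num)
  have hts : ∀ E, Summable fun k => t k E := fun E => hsum.of_norm_bounded fun k => htb k E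
  refine ⟨⟨fun E => ∑' k, t k E, continuous_tsum htc hsum htb⟩, ?_⟩
  intro E E₁ E₂ a b ha hb hab hE hne
  obtain ⟨k, hk⟩ : ∃ k, ∫ x, d k x ∂(E₁ : Measure W) ≠ ∫ x, d k x ∂(E₂ : Measure W) := by
    by_contra! hall
    refine hne (ProbabilityMeasure.toMeasure_injective
      (ext_of_forall_integral_eq_of_IsFiniteMeasure fun f => ?_))
    exact congrFun (Continuous.ext_on (TopologicalSpace.denseRange_denseSeq C(W, ℝ))
      (continuous_integral_continuousMap_left (E₁ : Measure W))
      (continuous_integral_continuousMap_left (E₂ : Measure W))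
      (by rintro _ ⟨k, rfl⟩; exact hall k)) f.toContinuousMap
  have hb' : b = 1 - a := by linarith
  -- The identity au² + bv² - (au + bv)² = ab(u - v)² for a + b = 1.
  have hgap : ∀ j, a * t j E₁ + b * t j E₂ - t j E = a * b * ((1 / 2) ^ j * (1 / (1 + ‖d j‖))) ^ 2 *
      (∫ x, d j x ∂(E₁ : Measure W) - ∫ x, d j x ∂(E₂ : Measure W)) ^ 2 := by
    intro j
    simp only [t, hE]
    rw [hb']
    ring
  have hle : ∀ j, t j E ≤ a * t j E₁ + b * t j E₂ := by
    intro j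
    rw [← sub_nonneg, hgap]
    positivity
  have hlt : t k E < a * t k E₁ + b * t k E₂ := by
    rw [← sub_pos, hgap]
    have : 0 < (∫ x, d k x ∂(E₁ : Measure W) - ∫ x, d k x ∂(E₂ : Measure W)) ^ 2 := by
      have := sub_ne_zero.2 hk
      positivity
    positivity
  have := Summable.tsum_lt_tsum hle hlt (hts E)
    (((hts E₁).mul_left a).add ((hts E₂).mul_left b))
  rwa [((hts E₁).mul_left a).tsum_add ((hts E₂).mul_left b), tsum_mul_left, tsum_mul_left] at this

/-- Weak convergence can be tested after pushing forward under an embedding. -/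
lemma tendsto_of_tendsto_map_of_isEmbedding {Z W : Type*} [TopologicalSpace Z] [MeasurableSpace Z]
    [BorelSpace Z] [TopologicalSpace W] [MeasurableSpace W] [BorelSpace W] [HasOuterApproxClosed W]
    {i : Z → W} (hi : Topology.IsEmbedding i) {u : ℕ → ProbabilityMeasure Z}
    {E : ProbabilityMeasure Z}
    (h : Filter.Tendsto (fun n => (u n).map hi.continuous.measurable.aemeasurable) Filter.atTop
      (nhds (E.map hi.continuous.measurable.aemeasurable))) :
    Filter.Tendsto u Filter.atTop (nhds E) := by
  refine tendsto_of_forall_isOpen_le_liminf' fun G hG => ?_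
  obtain ⟨U, hU, rfl⟩ := hi.isOpen_iff.1 hG
  have := ProbabilityMeasure.le_liminf_measure_open_of_tendsto h hU
  simpa only [ProbabilityMeasure.toMeasure_map,
    Measure.map_apply hi.continuous.measurable hU.measurableSet] using this

/-- Integration against continuous functions, as affine functions on a space of measures. -/
def integralMap {W K : Type*} [TopologicalSpace W] [CompactSpace W] [MeasurableSpace W]
    [BorelSpace W] [TopologicalSpace K] (e : C(K, ProbabilityMeasure W)) :
    C(W, ℝ) →ₗ[ℝ] C(K, ℝ) where
  toFun φ := ⟨fun y => ∫ x, φ x ∂(e y : Measure W),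
    (ProbabilityMeasure.continuous_integral_continuousMap φ).comp e.continuous⟩
  map_add' φ ψ := by
    ext y
    exact integral_add (continuousMap_integrable φ _) (continuousMap_integrable ψ _)
  map_smul' c φ := by
    ext y
    exact integral_const_mul c _

/-- Choquet's theorem for a compact family of probability measures on a compact metrizable
space. -/
lemma exists_mixture_of_compact {W K : Type*} [TopologicalSpace W] [CompactSpace W]
    [TopologicalSpace.MetrizableSpace W] [MeasurableSpace W] [BorelSpace W]
    [TopologicalSpace K] [CompactSpace K] [T2Space K] [MeasurableSpace K] [BorelSpace K]
    (e : C(K, ProbabilityMeasure W)) (x : K) :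
    ∃ π : Measure K, IsProbabilityMeasure π ∧
      π.bind (fun y => (e y : Measure W)) = (e x : Measure W) ∧
      ∀ᵐ y ∂π, ∀ y₁ y₂ : K, ∀ a b : ℝ, 0 < a → 0 < b → a + b = 1 →
        (∀ φ : C(W, ℝ), ∫ x, φ x ∂(e y : Measure W)
          = a * ∫ x, φ x ∂(e y₁ : Measure W) + b * ∫ x, φ x ∂(e y₂ : Measure W)) → e y₁ = e y₂ := by
  obtain ⟨f, hf⟩ := exists_strictConvex (W := W)
  have h1 : (1 : C(K, ℝ)) ∈ LinearMap.range (integralMap e) :=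
    ⟨1, by ext y; simp [integralMap]⟩
  obtain ⟨π, hπ, hrep, hae⟩ := exists_representing_measure _ h1 (f.comp e) x
  have hmeas := measurable_toMeasure_of_continuous e.continuous
  refine ⟨π, hπ, ?_, ?_⟩
  · symm
    refine ext_of_forall_lintegral_eq_of_IsFiniteMeasure fun φ => ?_
    rw [Measure.lintegral_bind hmeas.aemeasurable
      φ.continuous.measurable.coe_nnreal_ennreal.aemeasurable]
    let ψ : C(W, ℝ) := ⟨fun w => φ w, NNReal.continuous_coe.comp φ.continuous⟩
    have hψ : ∀ E : ProbabilityMeasure W, ∫⁻ w, φ w ∂(E : Measure W)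
        = ENNReal.ofReal (∫ w, ψ w ∂(E : Measure W)) := by
      intro E
      rw [ofReal_integral_eq_lintegral_ofReal (continuousMap_integrable ψ _)
        (ae_of_all _ fun w => NNReal.coe_nonneg _)]
      simp [ψ]
    simp_rw [hψ]
    have := hrep (integralMap e ψ) ⟨ψ, rfl⟩
    change ∫ z, ∫ w, ψ w ∂(e z : Measure W) ∂π = ∫ w, ψ w ∂(e x : Measure W) at this
    rw [← this]
    exact ofReal_integral_eq_lintegral_ofReal (continuousMap_integrable (integralMap e ψ) π)
      (ae_of_all _ fun z => integral_nonneg fun w => NNReal.coe_nonneg _)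
  · filter_upwards [hae] with y hy y₁ y₂ a b ha hb hab hsum
    by_contra hne
    -- Take ε to be the strict convexity gap at y. The majorant is affine, so its value at y is at
    -- least a f(y₁) + b f(y₂), which contradicts its closeness to f(y).
    obtain ⟨_, ⟨φ, rfl⟩, hmaj, hlt⟩ := hy _ (sub_pos.2 (hf _ _ _ a b ha hb hab hsum hne))
    have e1 : f (e y₁) ≤ ∫ x, φ x ∂(e y₁ : Measure W) := hmaj y₁
    have e2 : f (e y₂) ≤ ∫ x, φ x ∂(e y₂ : Measure W) := hmaj y₂
    have e3 : ∫ x, φ x ∂(e y : Measure W) < f (e y) + (a * f (e y₁) + b * f (e y₂) - f (e y)) := hlt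
    rw [hsum] at e3
    nlinarith [mul_le_mul_of_nonneg_left e1 ha.le, mul_le_mul_of_nonneg_left e2 hb.le]

/-- Every element of a weakly closed set of probability measures on a Polish space is a mixture of
extreme elements of the set. -/
theorem exists_mixture_extremeElements {Z : Type*} [TopologicalSpace Z] [PolishSpace Z]
    [MeasurableSpace Z] [BorelSpace Z] {C : Set (ProbabilityMeasure Z)} (hC : IsClosed C)
    {P : ProbabilityMeasure Z} (hP : P ∈ C) :
    ∃ (T : Type) (_ : MeasurableSpace T) (π : Measure T) (κ : T → Measure Z),
      IsProbabilityMeasure π ∧ Measurable κ ∧ (∀ᵐ t ∂π, ∃ E ∈ extremeElements C, κ t = E) ∧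
      π.bind κ = P := by
  let := TopologicalSpace.upgradeIsCompletelyMetrizable Z
  obtain ⟨i, hi⟩ := Metric.PiNatEmbed.exists_embedding_to_hilbert_cube (X := Z)
  have him : MeasurableEmbedding i := hi.continuous.measurableEmbedding hi.injective
  have hiae : ∀ E : ProbabilityMeasure Z, AEMeasurable i (E : Measure Z) :=
    fun E => him.measurable.aemeasurable
  let push : ProbabilityMeasure Z → ProbabilityMeasure (ℕ → unitInterval) :=
    fun E => E.map (hiae E)
  -- The closure is compact, but it may contain measures charging points outside the range of the
  -- embedding.
  let K := closure (push '' C)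
  have : CompactSpace K := isCompact_iff_compactSpace.1 isClosed_closure.isCompact
  let : MeasurableSpace K := borel K
  have : BorelSpace K := ⟨rfl⟩
  let e : C(K, ProbabilityMeasure (ℕ → unitInterval)) := ⟨Subtype.val, continuous_subtype_val⟩
  have hpush : ∀ E ∈ C, push E ∈ K := fun E hE => subset_closure ⟨E, hE, rfl⟩
  obtain ⟨π, hπ, hbind, hae⟩ := exists_mixture_of_compact e ⟨push P, hpush P hP⟩
  have hmeas := measurable_toMeasure_of_continuous e.continuous
  have hκ : Measurable fun y : K => (e y : Measure (ℕ → unitInterval)).comap i := by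
    refine Measure.measurable_of_measurable_coe _ fun s hs => ?_
    simp_rw [him.comap_apply]
    exact (Measure.measurable_coe (him.measurableSet_image' hs)).comp hmeas
  refine ⟨K, inferInstance, π, fun y => (e y : Measure (ℕ → unitInterval)).comap i, hπ, hκ, ?_, ?_⟩
  -- The mixture P is carried by the range of i, hence so is almost every component.
  · have hrange : ∀ᵐ y ∂π, (e y : Measure (ℕ → unitInterval)) (Set.range i)ᶜ = 0 := by
      have h0 : (push P : Measure (ℕ → unitInterval)) (Set.range i)ᶜ = 0 := by
        simp only [push, ProbabilityMeasure.toMeasure_map]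
        rw [Measure.map_apply him.measurable him.measurableSet_range.compl]
        simp
      change π.bind (fun y => (e y : Measure (ℕ → unitInterval))) = push P at hbind
      rw [← hbind, Measure.bind_apply him.measurableSet_range.compl hmeas.aemeasurable] at h0
      exact (lintegral_eq_zero_iff
        ((Measure.measurable_coe him.measurableSet_range.compl).comp hmeas)).1 h0
    filter_upwards [hae, hrange] with y hy hy0
    have hmap : ((e y : Measure (ℕ → unitInterval)).comap i).map i = e y := by
      rw [him.map_comap]
      exact Measure.restrict_eq_self_of_ae_mem (mem_ae_iff.2 hy0)
    have hprob : IsProbabilityMeasure ((e y : Measure (ℕ → unitInterval)).comap i) := by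
      constructor
      rw [him.comap_apply, Set.image_univ, prob_compl_eq_zero_iff him.measurableSet_range] at *
      exact hy0
    let E : ProbabilityMeasure Z := ⟨_, hprob⟩
    have hE : push E = e y := ProbabilityMeasure.toMeasure_injective hmap
    -- A component carried by the range is a limit of pushed-forward elements of C; the convergence
    -- already holds on Z, and C is closed.
    have hEC : E ∈ C := by
      obtain ⟨v, hv, hvt⟩ := mem_closure_iff_seq_limit.1 y.2
      choose u hu huv using hv
      have hvu : v = fun n => push (u n) := funext fun n => (huv n).symm
      have : Filter.Tendsto u Filter.atTop (nhds E) := by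
        refine tendsto_of_tendsto_map_of_isEmbedding hi ?_
        change Filter.Tendsto (fun n => push (u n)) Filter.atTop (nhds (push E))
        rw [hE, ← hvu]
        exact hvt
      exact hC.mem_of_tendsto this (Filter.Eventually.of_forall hu)
    refine ⟨E, ?_, rfl⟩
    refine mem_extremePoints.2 ⟨⟨E, hEC, rfl⟩, ?_⟩
    rintro _ ⟨E₁, hE₁, rfl⟩ _ ⟨E₂, hE₂, rfl⟩ ⟨a, b, ha, hb, hab, hsum⟩
    -- Push-forward is affine, so a decomposition inside C is one inside K, where y admits only
    -- trivial ones.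
    have heq : push E₁ = push E₂ := by
      refine hy ⟨push E₁, hpush E₁ hE₁⟩ ⟨push E₂, hpush E₂ hE₂⟩ a b (NNReal.coe_pos.2 ha)
        (NNReal.coe_pos.2 hb) (by exact_mod_cast hab) fun φ => ?_
      rw [← hE]
      change ∫ x, φ x ∂(push E : Measure _) = a * ∫ x, φ x ∂(push E₁ : Measure _)
        + b * ∫ x, φ x ∂(push E₂ : Measure _)
      simp only [push, ProbabilityMeasure.toMeasure_map]
      rw [him.integral_map, him.integral_map, him.integral_map, ← hsum,
        integral_add_measure, integral_smul_nnreal_measure, integral_smul_nnreal_measure]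
      · rfl
      · exact Integrable.smul_measure_nnreal
          ((BoundedContinuousFunction.mkOfCompact φ).compContinuous ⟨i, hi.continuous⟩ |>.integrable _)
      · exact Integrable.smul_measure_nnreal
          ((BoundedContinuousFunction.mkOfCompact φ).compContinuous ⟨i, hi.continuous⟩ |>.integrable _)
    have h12 : (E₁ : Measure Z) = E₂ := by
      have h := congrArg (fun F : ProbabilityMeasure (ℕ → unitInterval) =>
        (F : Measure (ℕ → unitInterval)).comap i) heq
      simpa only [push, ProbabilityMeasure.toMeasure_map, him.comap_map] using h
    have h1 : (E₁ : Measure Z) = E := by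
      rw [← hsum]
      simp only [h12, ← add_smul, hab, one_smul]
    exact ⟨h1, h12.symm.trans h1⟩
  · ext s hs
    rw [Measure.bind_apply hs hκ.aemeasurable]
    simp_rw [him.comap_apply]
    rw [← Measure.bind_apply (him.measurableSet_image' hs) hmeas.aemeasurable, hbind]
    change (push P : Measure (ℕ → unitInterval)) (i '' s) = _
    simp only [push, ProbabilityMeasure.toMeasure_map]
    rw [him.map_apply, Set.preimage_image_eq _ hi.injective]

end ChoquetMeasures

/-! ### Common lower bounds of measures and averaging over mixtures -/

section Overlap

variable {Z : Type*} [MeasurableSpace Z]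

/-- If `μ ≤ ν` on the measurable subsets of `s`, then the restrictions to `s` are ordered. -/
lemma restrict_le_restrict_of_forall_subset {μ ν : Measure Z} {s : Set Z} (hs : MeasurableSet s)
    (h : ∀ t, MeasurableSet t → t ⊆ s → μ t ≤ ν t) : μ.restrict s ≤ ν.restrict s := by
  refine Measure.le_iff.2 fun t ht => ?_
  rw [Measure.restrict_apply ht, Measure.restrict_apply ht]
  exact h _ (ht.inter hs) Set.inter_subset_right

/-- Two finite measures have a common lower bound on `B` whose mass is the infimum of
`E (A ∩ B) + Q (Aᶜ ∩ B)` over a dense family of sets `A`. -/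
lemma exists_common_lower_bound (E Q : Measure Z) [IsFiniteMeasure E] [IsFiniteMeasure Q]
    {B : Set Z} (hB : MeasurableSet B) {𝒜 : Set (Set Z)} (h𝒜 : (E + Q).MeasureDense 𝒜) :
    ∃ m : Measure Z, m ≤ E ∧ m ≤ Q ∧ m Bᶜ = 0 ∧
      ⨅ A : 𝒜, (E (A.1 ∩ B) + Q (A.1ᶜ ∩ B)) ≤ m Set.univ := by
  -- Since E ≤ Q on s and Q ≤ E off s, the measure built below is the minimum of E and Q on B. The
  -- set s minimizes the expression in the infimum, and density lets members of 𝒜 approximate it.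
  obtain ⟨s, hs, hsE, hsQ⟩ := hahn_decomposition Q E
  have e1 : E.restrict (s ∩ B) ≤ Q.restrict (s ∩ B) :=
    restrict_le_restrict_of_forall_subset (hs.inter hB)
      fun t ht hts => hsE t ht (hts.trans Set.inter_subset_left)
  have e2 : Q.restrict (sᶜ ∩ B) ≤ E.restrict (sᶜ ∩ B) :=
    restrict_le_restrict_of_forall_subset (hs.compl.inter hB)
      fun t ht hts => hsQ t ht (hts.trans Set.inter_subset_left)
  have hsplit : ∀ μ : Measure Z, μ.restrict (s ∩ B) + μ.restrict (sᶜ ∩ B) ≤ μ := by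
    intro μ
    rw [← Measure.restrict_union (Disjoint.mono Set.inter_subset_left Set.inter_subset_left
      disjoint_compl_right) (hs.compl.inter hB)]
    exact Measure.restrict_le_self
  refine ⟨E.restrict (s ∩ B) + Q.restrict (sᶜ ∩ B), ?_, ?_, ?_, ?_⟩
  · exact (add_le_add le_rfl e2).trans (hsplit E)
  · exact (add_le_add e1 le_rfl).trans (hsplit Q)
  · simp only [Measure.coe_add, Pi.add_apply, Measure.restrict_apply hB.compl]
    have : ∀ u : Set Z, Bᶜ ∩ (u ∩ B) = ∅ := fun u => by
      ext; simp; tauto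
    simp [this]
  · simp only [Measure.coe_add, Pi.add_apply, Measure.restrict_apply MeasurableSet.univ,
      Set.univ_inter]
    refine ENNReal.le_of_forall_pos_le_add fun ε hε _ => ?_
    obtain ⟨A, hA, hAs⟩ := h𝒜.approx s hs (measure_ne_top _ _) ε (NNReal.coe_pos.2 hε)
    rw [ENNReal.ofReal_coe_nnreal] at hAs
    refine (iInf_le _ ⟨A, hA⟩).trans ?_
    have a1 : E (A ∩ B) ≤ E (s ∩ B) + E (symmDiff s A) := by
      refine (measure_mono ?_).trans (measure_union_le _ _)
      intro z hz
      by_cases h : z ∈ s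
      · exact Or.inl ⟨h, hz.2⟩
      · exact Or.inr (Or.inr ⟨hz.1, h⟩)
    have a2 : Q (Aᶜ ∩ B) ≤ Q (sᶜ ∩ B) + Q (symmDiff s A) := by
      refine (measure_mono ?_).trans (measure_union_le _ _)
      intro z hz
      by_cases h : z ∈ s
      · exact Or.inr (Or.inl ⟨h, hz.1⟩)
      · exact Or.inl ⟨h, hz.2⟩
    calc E (A ∩ B) + Q (Aᶜ ∩ B)
        ≤ (E (s ∩ B) + E (symmDiff s A)) + (Q (sᶜ ∩ B) + Q (symmDiff s A)) := add_le_add a1 a2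
      _ = (E (s ∩ B) + Q (sᶜ ∩ B)) + (E + Q) (symmDiff s A) := by
        rw [Measure.coe_add, Pi.add_apply]; ring
      _ ≤ _ := by gcongr

/-- Averaging argument: if any two members of `S` overlap by at least `c`, and `P`, `Q` are mixtures
of members of `S`, then for any measurable `B` some member of `S` overlaps with `Q` inside `B` and
another one with `P` outside of `B`, with total overlap at least `c`. -/
lemma exists_overlap_of_mixture [MeasurableSpace.CountablyGenerated Z] {S : Set (Measure Z)}
    (hS : ∀ E ∈ S, IsProbabilityMeasure E) {c : ℝ≥0∞}
    (hc : ∀ E ∈ S, ∀ E' ∈ S, ∀ D, MeasurableSet D → c ≤ E D + E' Dᶜ)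
    {T T' : Type*} [MeasurableSpace T] [MeasurableSpace T'] {π : Measure T} {ρ : Measure T'}
    [IsProbabilityMeasure π] [IsProbabilityMeasure ρ] {κ : T → Measure Z} {κ' : T' → Measure Z}
    (hκ : Measurable κ) (hκ' : Measurable κ') (hκS : ∀ᵐ t ∂π, κ t ∈ S) (hκS' : ∀ᵐ t ∂ρ, κ' t ∈ S)
    {P Q : Measure Z} [IsProbabilityMeasure P] [IsProbabilityMeasure Q]
    (hP : π.bind κ = P) (hQ : ρ.bind κ' = Q) {B : Set Z} (hB : MeasurableSet B) :
    ∃ E ∈ S, ∃ E' ∈ S, ∃ m m' : Measure Z, m ≤ E ∧ m ≤ Q ∧ m Bᶜ = 0 ∧ m' ≤ E' ∧ m' ≤ P ∧ m' B = 0 ∧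
      c ≤ m Set.univ + m' Set.univ := by
  -- A countable dense algebra keeps the infima below measurable in the mixing parameters.
  let 𝒜 := generateSetAlgebra (MeasurableSpace.countableGeneratingSet Z)
  have h𝒜c : 𝒜.Countable :=
    countable_generateSetAlgebra (MeasurableSpace.countable_countableGeneratingSet)
  have : Countable 𝒜 := h𝒜c.to_subtype
  have h𝒜a : IsSetAlgebra 𝒜 := isSetAlgebra_generateSetAlgebra
  have h𝒜 : ∀ μ : Measure Z, IsFiniteMeasure μ → μ.MeasureDense 𝒜 := fun μ _ =>
    Measure.MeasureDense.of_generateFrom_isSetAlgebra_finite μ h𝒜a (by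
      rw [generateFrom_generateSetAlgebra_eq, MeasurableSpace.generateFrom_countableGeneratingSet])
  have hm𝒜 : ∀ A : 𝒜, MeasurableSet A.1 := fun A => (h𝒜 P inferInstance).measurable _ A.2
  have hmE : ∀ u, MeasurableSet u → Measurable fun t => κ t u :=
    fun u hu => (Measure.measurable_coe hu).comp hκ
  have hmE' : ∀ u, MeasurableSet u → Measurable fun t => κ' t u :=
    fun u hu => (Measure.measurable_coe hu).comp hκ'
  let f : Set Z → T → T' → ℝ≥0∞ := fun B t t' => ⨅ A : 𝒜, (κ t (A.1 ∩ B) + κ' t' (A.1ᶜ ∩ B))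
  let a : T → ℝ≥0∞ := fun t => ⨅ A : 𝒜, (κ t (A.1 ∩ B) + Q (A.1ᶜ ∩ B))
  let b : T' → ℝ≥0∞ := fun t' => ⨅ A : 𝒜, (P (A.1 ∩ Bᶜ) + κ' t' (A.1ᶜ ∩ Bᶜ))
  have hfm : ∀ B, MeasurableSet B → Measurable (Function.uncurry (f B)) := by
    intro B hB
    exact Measurable.iInf fun A => ((hmE _ ((hm𝒜 A).inter hB)).comp measurable_fst).add
      ((hmE' _ ((hm𝒜 A).compl.inter hB)).comp measurable_snd)
  have ham : Measurable a := Measurable.iInf fun A =>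
    (hmE _ ((hm𝒜 A).inter hB)).add measurable_const
  have hbm : Measurable b := Measurable.iInf fun A =>
    measurable_const.add (hmE' _ ((hm𝒜 A).compl.inter hB.compl))
  -- An integral of infima is at most the infimum of the integrals; integrating over t' turns κ' t'
  -- into Q.
  have hfa : ∀ t, ∫⁻ t', f B t t' ∂ρ ≤ a t := by
    intro t
    refine le_iInf fun A => (lintegral_mono fun t' => iInf_le _ A).trans ?_
    rw [lintegral_add_left measurable_const, lintegral_const, measure_univ, mul_one,
      ← Measure.bind_apply ((hm𝒜 A).compl.inter hB) hκ'.aemeasurable, hQ]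
  have hfb : ∀ t', ∫⁻ t, f Bᶜ t t' ∂π ≤ b t' := by
    intro t'
    refine le_iInf fun A => (lintegral_mono fun t => iInf_le _ A).trans ?_
    rw [lintegral_add_right _ measurable_const, lintegral_const, measure_univ, mul_one,
      ← Measure.bind_apply ((hm𝒜 A).inter hB.compl) hκ.aemeasurable, hP]
  have hcf : ∀ᵐ t ∂π, ∀ᵐ t' ∂ρ, c ≤ f B t t' + f Bᶜ t t' := by
    filter_upwards [hκS] with t ht
    filter_upwards [hκS'] with t' ht'
    simp only [f]
    rw [ENNReal.iInf_add]
    refine le_iInf fun A => ?_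
    rw [ENNReal.add_iInf]
    refine le_iInf fun A' => ?_
    -- The two infima use unrelated sets A and A'; gluing them along B gives a single test set D.
    refine (hc _ ht _ ht' ((A.1 ∩ B) ∪ (A'.1 ∩ Bᶜ))
      (((hm𝒜 A).inter hB).union ((hm𝒜 A').inter hB.compl))).trans ?_
    have e : ((A.1 ∩ B) ∪ (A'.1 ∩ Bᶜ))ᶜ = (A.1ᶜ ∩ B) ∪ (A'.1ᶜ ∩ Bᶜ) := by
      ext z
      simp only [Set.mem_compl_iff, Set.mem_union, Set.mem_inter_iff]
      tauto
    rw [e]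
    refine (add_le_add (measure_union_le _ _) (measure_union_le _ _)).trans (le_of_eq ?_)
    ring
  have hint : c ≤ ∫⁻ t, a t ∂π + ∫⁻ t', b t' ∂ρ := by
    calc c = ∫⁻ _, ∫⁻ _, c ∂ρ ∂π := by simp
      _ ≤ ∫⁻ t, ∫⁻ t', (f B t t' + f Bᶜ t t') ∂ρ ∂π :=
        lintegral_mono_ae (hcf.mono fun t ht => lintegral_mono_ae ht)
      _ = ∫⁻ t, (∫⁻ t', f B t t' ∂ρ + ∫⁻ t', f Bᶜ t t' ∂ρ) ∂π := by
        refine lintegral_congr fun t => lintegral_add_left ?_ _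
        exact (hfm B hB).of_uncurry_left
      _ = ∫⁻ t, ∫⁻ t', f B t t' ∂ρ ∂π + ∫⁻ t, ∫⁻ t', f Bᶜ t t' ∂ρ ∂π :=
        lintegral_add_left (hfm B hB).lintegral_prod_right' _
      _ = ∫⁻ t, ∫⁻ t', f B t t' ∂ρ ∂π + ∫⁻ t', ∫⁻ t, f Bᶜ t t' ∂π ∂ρ := by
        rw [lintegral_lintegral_swap (hfm Bᶜ hB.compl).aemeasurable]
      _ ≤ _ := add_le_add (lintegral_mono hfa) (lintegral_mono hfb)
  have hne : (∅ : Set Z) ∈ 𝒜 := h𝒜a.empty_mem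
  have hafin : ∫⁻ t, a t ∂π ≠ ∞ := by
    refine ne_top_of_le_ne_top (b := Q B) (measure_ne_top _ _) ?_
    refine (lintegral_mono fun t => (iInf_le _ ⟨∅, hne⟩ : a t ≤ _)).trans ?_
    simp
  have hbfin : ∫⁻ t, b t ∂ρ ≠ ∞ := by
    refine ne_top_of_le_ne_top (b := P Bᶜ) (measure_ne_top _ _) ?_
    refine (lintegral_mono fun t => (iInf_le _ ⟨Set.univ, h𝒜a.univ_mem⟩ : b t ≤ _)).trans ?_
    simp
  -- After averaging, a depends on t alone and b on t' alone, so the two parameters can be chosen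
  -- independently, each at or above its mean.
  obtain ⟨t, ht, hat⟩ := exists_notMem_null_lintegral_le hafin (mem_ae_iff.1 hκS)
  obtain ⟨t', ht', hbt⟩ := exists_notMem_null_lintegral_le hbfin (mem_ae_iff.1 hκS')
  have ht : κ t ∈ S := by simpa using ht
  have ht' : κ' t' ∈ S := by simpa using ht'
  have := hS _ ht
  have := hS _ ht'
  obtain ⟨m, hm1, hm2, hm3, hm4⟩ := exists_common_lower_bound (κ t) Q hB (h𝒜 _ inferInstance)
  obtain ⟨m', hm1', hm2', hm3', hm4'⟩ :=
    exists_common_lower_bound P (κ' t') hB.compl (h𝒜 _ inferInstance)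
  refine ⟨_, ht, _, ht', m, m', hm1, hm2, hm3, hm2', hm1', by simpa using hm3', ?_⟩
  exact hint.trans (add_le_add (hat.trans hm4) (hbt.trans hm4'))

/-- A finite measure `m ≤ P` has a density with values in the unit interval. -/
lemma exists_density_unitInterval {m P : Measure Z} [IsFiniteMeasure P] (hm : m ≤ P) :
    ∃ g : Z → ℝ, Measurable g ∧ (∀ z, 0 ≤ g z) ∧ (∀ z, g z ≤ 1) ∧
      m = P.withDensity fun z => ENNReal.ofReal (g z) := by
  have : IsFiniteMeasure m := isFiniteMeasure_of_le P hm
  -- The density is at most 1 only almost everywhere; truncation makes the bound hold at every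
  -- point.
  refine ⟨fun z => min (m.rnDeriv P z).toReal 1, (Measure.measurable_rnDeriv m P).ennreal_toReal.min
    measurable_const, fun z => le_min ENNReal.toReal_nonneg zero_le_one, fun z => min_le_right _ _,
    ?_⟩
  nth_rewrite 1 [← Measure.withDensity_rnDeriv_eq m P (Measure.absolutelyContinuous_of_le hm)]
  refine withDensity_congr_ae ?_
  filter_upwards [Measure.rnDeriv_le_one_of_le hm] with z hz
  have hz' : (m.rnDeriv P z).toReal ≤ 1 := ENNReal.toReal_le_of_le_ofReal zero_le_one (by simpa using hz)
  rw [min_eq_left hz', ENNReal.ofReal_toReal (ne_top_of_le_ne_top ENNReal.one_ne_top hz)]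

end Overlap

/-! ### Product measures: coordinatewise comparison and McDiarmid's inequality -/

section ProductMeasures

variable {W : Type*} [MeasurableSpace W]

lemma integrable_of_abs_le {μ : Measure W} [IsFiniteMeasure μ] {F : W → ℝ} (hF : Measurable F)
    {M : ℝ} (hM : ∀ w, |F w| ≤ M) : Integrable F μ :=
  Integrable.of_bound hF.aestronglyMeasurable M (ae_of_all _ hM)

lemma abs_integral_le_of_abs_le {μ : Measure W} [IsProbabilityMeasure μ] {F : W → ℝ}
    {M : ℝ} (hM : ∀ w, |F w| ≤ M) : |∫ w, F w ∂μ| ≤ M := by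
  have h : ∀ᵐ w ∂μ, ‖F w‖ ≤ M := ae_of_all _ hM
  simpa using norm_integral_le_of_norm_le_const h

lemma measurable_cons {n : ℕ} :
    Measurable fun p : W × (Fin n → W) => (Fin.cons p.1 p.2 : Fin (n + 1) → W) := by
  refine measurable_pi_lambda _ fun i => ?_
  refine Fin.cases ?_ (fun j => ?_) i
  · simpa using measurable_fst
  · simp only [Fin.cons_succ]
    exact (measurable_pi_apply j).comp measurable_snd

lemma integral_pi_succ (m : Measure W) [IsProbabilityMeasure m] {n : ℕ}
    {F : (Fin (n + 1) → W) → ℝ} (hF : Measurable F) {M : ℝ} (hM : ∀ w, |F w| ≤ M) :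
    ∫ w, F w ∂(Measure.pi fun _ => m)
      = ∫ x, ∫ w, F (Fin.cons x w) ∂(Measure.pi fun _ => m) ∂m := by
  have h := (measurePreserving_piFinSuccAbove (fun _ : Fin (n + 1) => m) 0).symm
  rw [← h.integral_comp', integral_prod]
  · simp [MeasurableEquiv.piFinSuccAbove, Fin.consEquiv]
  · exact integrable_of_abs_le (hF.comp (MeasurableEquiv.measurable _)) fun w => hM _

/-- Coordinatewise comparison of product measures. -/
lemma integral_pi_le_integral_pi (m m' : Measure W) [IsProbabilityMeasure m]
    [IsProbabilityMeasure m'] {n : ℕ} {F : (Fin n → W) → ℝ} (hF : Measurable F) {M : ℝ}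
    (hM : ∀ w, |F w| ≤ M)
    (h : ∀ w i, ∫ x, F (Function.update w i x) ∂m ≤ ∫ x, F (Function.update w i x) ∂m') :
    ∫ w, F w ∂(Measure.pi fun _ => m) ≤ ∫ w, F w ∂(Measure.pi fun _ => m') := by
  induction n with
  | zero => simp [integral_unique]
  | succ n ih =>
    have hc := hF.comp (measurable_cons (W := W) (n := n))
    rw [integral_pi_succ m hF hM, integral_pi_succ m' hF hM]
    -- The tail is replaced by induction, then the head after exchanging the order of integration.
    calc ∫ x, ∫ w, F (Fin.cons x w) ∂(Measure.pi fun _ => m) ∂m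
        ≤ ∫ x, ∫ w, F (Fin.cons x w) ∂(Measure.pi fun _ => m') ∂m := by
          refine integral_mono ?_ ?_ fun x => ?_
          · exact integrable_of_abs_le hc.stronglyMeasurable.integral_prod_right'.measurable
              fun x => abs_integral_le_of_abs_le fun w => hM _
          · exact integrable_of_abs_le hc.stronglyMeasurable.integral_prod_right'.measurable
              fun x => abs_integral_le_of_abs_le fun w => hM _
          · refine ih (hc.comp (measurable_prodMk_left (x := x))) (fun w => hM _) fun w i => ?_
            simpa only [Function.comp_apply, Fin.cons_update] using h (Fin.cons x w) i.succ
      _ = ∫ w, ∫ x, F (Fin.cons x w) ∂m ∂(Measure.pi fun _ => m') :=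
          integral_integral_swap (f := fun x w => F (Fin.cons x w))
            (integrable_of_abs_le (F := Function.uncurry fun x w => F (Fin.cons x w)) hc fun w => hM _)
      _ ≤ ∫ w, ∫ x, F (Fin.cons x w) ∂m' ∂(Measure.pi fun _ => m') := by
          have hc' := hc.comp measurable_swap
          refine integral_mono ?_ ?_ fun w => ?_
          · exact integrable_of_abs_le hc'.stronglyMeasurable.integral_prod_right'.measurable
              fun x => abs_integral_le_of_abs_le fun w => hM _
          · exact integrable_of_abs_le hc'.stronglyMeasurable.integral_prod_right'.measurable
              fun x => abs_integral_le_of_abs_le fun w => hM _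
          · obtain ⟨x₀⟩ : Nonempty W := nonempty_of_isProbabilityMeasure m
            simpa only [Fin.update_cons_zero] using h (Fin.cons x₀ w) 0
      _ = ∫ x, ∫ w, F (Fin.cons x w) ∂(Measure.pi fun _ => m') ∂m' :=
          (integral_integral_swap (f := fun x w => F (Fin.cons x w))
            (integrable_of_abs_le (F := Function.uncurry fun x w => F (Fin.cons x w)) hc fun w => hM _)).symm

lemma measurable_exp_sub {F : W → ℝ} (hF : Measurable F) (t a : ℝ) :
    Measurable fun w => Real.exp (t * (F w - a)) :=
  ((hF.sub_const a).const_mul t).exp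

lemma abs_exp_sub_le {V : Type*} {F : V → ℝ} {M : ℝ} (hM : ∀ w, |F w| ≤ M) {t a : ℝ} (ha : |a| ≤ M) (w : V) :
    |Real.exp (t * (F w - a))| ≤ Real.exp (|t| * (2 * M)) := by
  rw [abs_of_pos (Real.exp_pos _), Real.exp_le_exp]
  refine (le_abs_self _).trans ?_
  rw [abs_mul]
  refine mul_le_mul_of_nonneg_left ?_ (abs_nonneg _)
  linarith [abs_sub (F w) a, hM w]

/-- McDiarmid's inequality in terms of the moment generating function. -/
lemma integral_exp_le_of_bounded_differences (m : Measure W) [IsProbabilityMeasure m] {c : ℝ}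
    (hc : 0 ≤ c) (t : ℝ) {n : ℕ} {F : (Fin n → W) → ℝ} (hF : Measurable F) {M : ℝ}
    (hM : ∀ w, |F w| ≤ M) (h : ∀ w i x, F (Function.update w i x) ≤ F w + c) :
    ∫ w, Real.exp (t * (F w - ∫ v, F v ∂(Measure.pi fun _ => m))) ∂(Measure.pi fun _ => m)
      ≤ Real.exp (n * c ^ 2 * t ^ 2 / 8) := by
  induction n with
  | zero => simp [integral_unique]
  | succ n ih =>
    have hcons := hF.comp (measurable_cons (W := W) (n := n))
    obtain ⟨x₀⟩ : Nonempty W := nonempty_of_isProbabilityMeasure m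
    -- G is the conditional mean given the first coordinate. Induction handles F - G, and
    -- Hoeffding's lemma handles G, whose range lies in an interval of length c; this contributes
    -- (c/2)²t²/2 = c²t²/8.
    let G : W → ℝ := fun x => ∫ w, F (Fin.cons x w) ∂(Measure.pi fun _ => m)
    have hGm : Measurable G := hcons.stronglyMeasurable.integral_prod_right'.measurable
    have hGM : ∀ x, |G x| ≤ M := fun x => abs_integral_le_of_abs_le fun w => hM _
    have hFx : ∀ x, Measurable fun w : Fin n → W => F (Fin.cons x w) :=
      fun x => hcons.comp (measurable_prodMk_left (x := x))
    have hGc : ∀ x y, G y ≤ G x + c := by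
      intro x y
      have : G x + c = ∫ w, (F (Fin.cons x w) + c) ∂(Measure.pi fun _ => m) := by
        rw [integral_add (integrable_of_abs_le (hFx x) fun w => hM _) (integrable_const _)]
        simp [G]
      rw [this]
      refine integral_mono (integrable_of_abs_le (hFx y) fun w => hM _)
        ((integrable_of_abs_le (hFx x) fun w => hM _).add (integrable_const _)) fun w => ?_
      simpa only [Fin.update_cons_zero] using h (Fin.cons x w) 0 y
    have hbdd : BddBelow (Set.range G) := ⟨-M, by rintro _ ⟨x, rfl⟩; exact (abs_le.1 (hGM x)).1⟩
    have hIcc : ∀ᵐ x ∂m, G x ∈ Set.Icc (⨅ x, G x) ((⨅ x, G x) + c) := by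
      have : Nonempty W := ⟨x₀⟩
      refine ae_of_all _ fun y => ⟨ciInf_le hbdd y, ?_⟩
      rw [← sub_le_iff_le_add]
      exact le_ciInf fun x => sub_le_iff_le_add.2 (hGc x y)
    have hsub := (hasSubgaussianMGF_of_mem_Icc hGm.aemeasurable hIcc).mgf_le t
    have hEF : ∫ v, F v ∂(Measure.pi fun _ => m) = ∫ x, G x ∂m := integral_pi_succ m hF hM
    have hEM : |∫ v, F v ∂(Measure.pi fun _ => m)| ≤ M := abs_integral_le_of_abs_le hM
    rw [integral_pi_succ m (measurable_exp_sub hF t _) (abs_exp_sub_le hM hEM), hEF]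
    calc ∫ x, ∫ w, Real.exp (t * (F (Fin.cons x w) - ∫ x, G x ∂m)) ∂(Measure.pi fun _ => m) ∂m
        ≤ ∫ x, Real.exp (n * c ^ 2 * t ^ 2 / 8) * Real.exp (t * (G x - ∫ x, G x ∂m)) ∂m := by
          refine integral_mono ?_ ?_ fun x => ?_
          · exact integrable_of_abs_le ((measurable_exp_sub hcons t
              _).stronglyMeasurable.integral_prod_right'.measurable)
              fun x => abs_integral_le_of_abs_le fun w =>
                abs_exp_sub_le (F := F) hM (hEF ▸ hEM) (Fin.cons x w)
          · exact (integrable_of_abs_le (measurable_exp_sub hGm t _)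
              (abs_exp_sub_le hGM (hEF ▸ hEM))).const_mul _
          · have e : ∀ w : Fin n → W, Real.exp (t * (F (Fin.cons x w) - ∫ x, G x ∂m))
                = Real.exp (t * (F (Fin.cons x w) - G x)) * Real.exp (t * (G x - ∫ x, G x ∂m)) := by
              intro w
              rw [← Real.exp_add]
              ring_nf
            simp_rw [e]
            rw [integral_mul_const]
            refine mul_le_mul_of_nonneg_right ?_ (Real.exp_pos _).le
            refine ih (hFx x) (fun w => hM _) fun w i y => ?_
            simpa only [Fin.cons_update] using h (Fin.cons x w) i.succ y
      _ ≤ Real.exp (n * c ^ 2 * t ^ 2 / 8) * Real.exp ((c / 2) ^ 2 * t ^ 2 / 2) := by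
          rw [integral_const_mul]
          refine mul_le_mul_of_nonneg_left ?_ (Real.exp_pos _).le
          simpa [mgf, abs_of_nonneg hc] using hsub
      _ = Real.exp ((n + 1 : ℕ) * c ^ 2 * t ^ 2 / 8) := by
          rw [← Real.exp_add]
          push_cast
          ring_nf

/-- McDiarmid's bounded differences inequality. -/
lemma measure_ge_le_of_bounded_differences (m : Measure W) [IsProbabilityMeasure m] {c : ℝ}
    (hc : 0 ≤ c) {n : ℕ} {F : (Fin n → W) → ℝ} (hF : Measurable F) {M : ℝ}
    (hM : ∀ w, |F w| ≤ M) (h : ∀ w i x, F (Function.update w i x) ≤ F w + c) {s : ℝ} (hs : 0 ≤ s) :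
    (Measure.pi fun _ => m).real {w | s ≤ F w - ∫ v, F v ∂(Measure.pi fun _ => m)}
      ≤ Real.exp (-s ^ 2 / (2 * (n * c ^ 2 / 4))) := by
  have hEM : |∫ v, F v ∂(Measure.pi fun _ => m)| ≤ M := abs_integral_le_of_abs_le hM
  have hsub : HasSubgaussianMGF (fun w => F w - ∫ v, F v ∂(Measure.pi fun _ => m))
      (n * c ^ 2 / 4).toNNReal (Measure.pi fun _ => m) := by
    refine ⟨fun t => integrable_of_abs_le (measurable_exp_sub hF t _) (abs_exp_sub_le hM hEM),
      fun t => (integral_exp_le_of_bounded_differences m hc t hF hM h).trans (le_of_eq ?_)⟩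
    rw [Real.coe_toNNReal _ (by positivity)]
    ring_nf
  simpa only [Real.coe_toNNReal _ (show 0 ≤ n * c ^ 2 / 4 by positivity)]
    using hsub.measure_ge_le hs

end ProductMeasures

/-! ### Weighted suprema over the loss class -/

section WeightedSup

variable {X Y : Type*}

lemma loss_nonneg (z : X × Y) (h : X → Y) : 0 ≤ loss z h := by
  unfold loss; split_ifs <;> norm_num

lemma loss_le_one (z : X × Y) (h : X → Y) : loss z h ≤ 1 := by
  unfold loss; split_ifs <;> norm_num

lemma abs_loss_le_one (z : X × Y) (h : X → Y) : |loss z h| ≤ 1 := by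
  rw [abs_of_nonneg (loss_nonneg z h)]; exact loss_le_one z h

/-- The weighted supremum `sup_{h ∈ H} ∑ᵢ aᵢ l(wᵢ, h)`. -/
def weightedSup (H : Set (X → Y)) {κ : Type*} [Fintype κ] (a : κ → ℝ) (w : κ → X × Y) : ℝ :=
  ⨆ h : H, ∑ i, a i * loss (w i) h

variable {H : Set (X → Y)} {κ : Type*} [Fintype κ]

lemma abs_sum_mul_loss_le (a : κ → ℝ) (w : κ → X × Y) (h : X → Y) :
    |∑ i, a i * loss (w i) h| ≤ ∑ i, |a i| := by
  refine (Finset.abs_sum_le_sum_abs _ _).trans (Finset.sum_le_sum fun i _ => ?_)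
  rw [abs_mul]
  exact mul_le_of_le_one_right (abs_nonneg _) (abs_loss_le_one _ _)

lemma sum_le_weightedSup (a : κ → ℝ) (w : κ → X × Y) {h : X → Y} (hh : h ∈ H) :
    ∑ i, a i * loss (w i) h ≤ weightedSup H a w := by
  refine le_ciSup (f := fun h : H => ∑ i, a i * loss (w i) h) ⟨∑ i, |a i|, ?_⟩ ⟨h, hh⟩
  rintro _ ⟨h, rfl⟩
  exact (le_abs_self _).trans (abs_sum_mul_loss_le a w h)

lemma weightedSup_le [Nonempty H] {a : κ → ℝ} {w : κ → X × Y} {r : ℝ}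
    (hr : ∀ h ∈ H, ∑ i, a i * loss (w i) h ≤ r) : weightedSup H a w ≤ r :=
  ciSup_le fun h => hr h h.2

lemma abs_weightedSup_le [Nonempty H] (a : κ → ℝ) (w : κ → X × Y) :
    |weightedSup H a w| ≤ ∑ i, |a i| := by
  obtain ⟨h, hh⟩ := (inferInstance : Nonempty H)
  refine abs_le.2 ⟨?_, weightedSup_le fun h _ => (abs_le.1 (abs_sum_mul_loss_le a w h)).2⟩
  exact (abs_le.1 (abs_sum_mul_loss_le a w h)).1.trans (sum_le_weightedSup a w hh)

lemma weightedSup_le_add_sum_abs [Nonempty H] (a b : κ → ℝ) (w : κ → X × Y) :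
    weightedSup H a w ≤ weightedSup H b w + ∑ i, |a i - b i| := by
  refine weightedSup_le fun h hh => ?_
  have e : ∑ i, a i * loss (w i) h
      = ∑ i, b i * loss (w i) h + ∑ i, (a i - b i) * loss (w i) h := by
    rw [← Finset.sum_add_distrib]
    exact Finset.sum_congr rfl fun i _ => by ring
  rw [e]
  exact add_le_add (sum_le_weightedSup b w hh)
    (abs_le.1 (abs_sum_mul_loss_le (fun i => a i - b i) w h)).2

lemma continuous_weightedSup [Nonempty H] (w : κ → X × Y) :
    Continuous fun a => weightedSup H a w := by
  refine LipschitzWith.continuous (K := Fintype.card κ) (LipschitzWith.of_dist_le_mul fun a b => ?_)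
  have hs : ∀ a b : κ → ℝ, ∑ i, |a i - b i| ≤ Fintype.card κ * dist a b := by
    intro a b
    refine (Finset.sum_le_card_nsmul _ _ (dist a b) fun i _ => ?_).trans (by simp)
    exact dist_le_pi_dist a b i
  rw [Real.dist_eq, abs_sub_le_iff, NNReal.coe_natCast]
  constructor
  · linarith [weightedSup_le_add_sum_abs (H := H) a b w, hs a b]
  · have := hs b a
    rw [dist_comm] at this
    linarith [weightedSup_le_add_sum_abs (H := H) b a w]

variable [MeasurableSpace X] [MeasurableSpace Y]

/-- The class hypothesis covers fixed weights only. The supremum is Lipschitz in the weights, so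
joint measurability follows, and the weights may then depend on the sample. -/
lemma measurable_weightedSup [Nonempty H] (hH : IsMeasurableClass H) :
    Measurable fun p : (κ → ℝ) × (κ → X × Y) => weightedSup H p.1 p.2 := by
  refine measurable_uncurry_of_continuous_of_measurable (u := weightedSup H)
    continuous_weightedSup fun a => ?_
  let e := Fintype.equivFin κ
  have hm := (hH (Fintype.card κ) (a ∘ e.symm)).comp
    (measurable_pi_lambda (fun (w : κ → X × Y) j => w (e.symm j))
      fun j => measurable_pi_apply (e.symm j))
  convert hm using 1
  ext w
  refine iSup_congr fun h => ?_
  exact (Equiv.sum_comp e.symm fun i => a i * loss (w i) h).symm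

lemma measurable_weightedSup_comp [Nonempty H] (hH : IsMeasurableClass H) {T : Type*}
    [MeasurableSpace T] {a : T → κ → ℝ} {w : T → κ → X × Y} (ha : ∀ i, Measurable fun t => a t i)
    (hw : ∀ i, Measurable fun t => w t i) : Measurable fun t => weightedSup H (a t) (w t) :=
  (measurable_weightedSup hH).comp
    ((measurable_pi_lambda _ ha).prodMk (measurable_pi_lambda _ hw))

end WeightedSup

/-! ### Weighted Rademacher averages -/

section Rademacher

variable {X Y : Type*} {H : Set (X → Y)} {n : ℕ}

/-- The average of `sup_{h ∈ H} ∑ᵢ σᵢ aᵢ l(wᵢ, h)` over all sign vectors `σ`. -/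
def signAverage (H : Set (X → Y)) (a : Fin n → ℝ) (w : Fin n → X × Y) : ℝ :=
  (1 / (2 : ℝ) ^ n) * ∑ σ : Fin n → ℤˣ, weightedSup H (fun i => ((σ i : ℤ) : ℝ) * a i) w

lemma abs_sign (u : ℤˣ) : |((u : ℤ) : ℝ)| = 1 := by
  rcases Int.units_eq_one_or u with rfl | rfl <;> simp

lemma sum_signs_const (r : ℝ) : (1 / (2 : ℝ) ^ n) * ∑ _σ : Fin n → ℤˣ, r = r := by
  simp

lemma signAverage_mono {a b : Fin n → ℝ} {w v : Fin n → X × Y}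
    (h : ∑ σ : Fin n → ℤˣ, weightedSup H (fun i => ((σ i : ℤ) : ℝ) * a i) w
      ≤ ∑ σ : Fin n → ℤˣ, weightedSup H (fun i => ((σ i : ℤ) : ℝ) * b i) v) :
    signAverage H a w ≤ signAverage H b v :=
  mul_le_mul_of_nonneg_left h (by positivity)

lemma abs_signAverage_le [Nonempty H] {a : Fin n → ℝ} (ha : ∀ i, |a i| ≤ 1) (w : Fin n → X × Y) :
    |signAverage H a w| ≤ n := by
  have h : ∀ σ : Fin n → ℤˣ, |weightedSup H (fun i => ((σ i : ℤ) : ℝ) * a i) w| ≤ n := by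
    intro σ
    refine (abs_weightedSup_le _ _).trans ?_
    refine (Finset.sum_le_card_nsmul _ _ 1 fun i _ => ?_).trans (by simp)
    rw [abs_mul, abs_sign, one_mul]
    exact ha i
  rw [signAverage, abs_mul, abs_of_nonneg (by positivity), ← sum_signs_const (n := n) (n : ℝ)]
  exact mul_le_mul_of_nonneg_left
    ((Finset.abs_sum_le_sum_abs _ _).trans (Finset.sum_le_sum fun σ _ => h σ)) (by positivity)

/-- Averaging σ with its flip at i cancels the i-th term, and the supremum of an average is at most
the average of the suprema. -/
lemma signAverage_update_zero_le_one [Nonempty H] (a : Fin n → ℝ) (w : Fin n → X × Y) (i : Fin n) :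
    signAverage H (Function.update a i 0) w ≤ signAverage H (Function.update a i 1) w := by
  refine signAverage_mono ?_
  let flip : (Fin n → ℤˣ) → (Fin n → ℤˣ) := fun σ => Function.update σ i (-σ i)
  have hflip : Function.Involutive flip := fun σ => by simp [flip]
  let S : (Fin n → ℤˣ) → ℝ := fun σ =>
    weightedSup H (fun j => ((σ j : ℤ) : ℝ) * Function.update a i 1 j) w
  have hterm : ∀ σ : Fin n → ℤˣ,
      weightedSup H (fun j => ((σ j : ℤ) : ℝ) * Function.update a i 0 j) w
        ≤ (S σ + S (flip σ)) / 2 := by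
    intro σ
    refine weightedSup_le fun h hh => ?_
    have h1 := sum_le_weightedSup (fun j => ((σ j : ℤ) : ℝ) * Function.update a i 1 j) w hh
    have h2 := sum_le_weightedSup (fun j => ((flip σ j : ℤ) : ℝ) * Function.update a i 1 j) w hh
    have e : ∑ j, ((σ j : ℤ) : ℝ) * Function.update a i 0 j * loss (w j) h
        = (∑ j, ((σ j : ℤ) : ℝ) * Function.update a i 1 j * loss (w j) h
          + ∑ j, ((flip σ j : ℤ) : ℝ) * Function.update a i 1 j * loss (w j) h) / 2 := by
      rw [← Finset.sum_add_distrib, Finset.sum_div]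
      refine Finset.sum_congr rfl fun j _ => ?_
      by_cases hj : j = i
      · subst hj; simp [flip]
      · simp [flip, hj]
    rw [e]
    simp only [S]
    linarith
  calc _ ≤ ∑ σ, (S σ + S (flip σ)) / 2 := Finset.sum_le_sum fun σ _ => hterm σ
    _ = (∑ σ, S σ + ∑ σ, S (hflip.toPerm flip σ)) / 2 := by
      rw [← Finset.sum_add_distrib, Finset.sum_div]; rfl
    _ = ∑ σ, S σ := by rw [Equiv.sum_comp]; ring

/-- A supremum of linear functions of the weights is convex. -/
lemma signAverage_update_le [Nonempty H] (a : Fin n → ℝ) (w : Fin n → X × Y) (i : Fin n) {t : ℝ}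
    (h0 : 0 ≤ t) (h1 : t ≤ 1) :
    signAverage H (Function.update a i t) w ≤ (1 - t) * signAverage H (Function.update a i 0) w
      + t * signAverage H (Function.update a i 1) w := by
  have e : ∀ A B C D : ℝ, (1 - t) * (A * B) + t * (A * C) = A * ((1 - t) * B + t * C) := by
    intros; ring
  unfold signAverage
  rw [e _ _ _ 0]
  refine mul_le_mul_of_nonneg_left ?_ (by positivity)
  rw [Finset.mul_sum, Finset.mul_sum, ← Finset.sum_add_distrib]
  refine Finset.sum_le_sum fun σ _ => weightedSup_le fun h hh => ?_
  have a1 := mul_le_mul_of_nonneg_left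
    (sum_le_weightedSup (fun j => ((σ j : ℤ) : ℝ) * Function.update a i 0 j) w hh)
    (sub_nonneg.2 h1)
  have a2 := mul_le_mul_of_nonneg_left
    (sum_le_weightedSup (fun j => ((σ j : ℤ) : ℝ) * Function.update a i 1 j) w hh) h0
  refine le_trans (le_of_eq ?_) (add_le_add a1 a2)
  rw [Finset.mul_sum, Finset.mul_sum, ← Finset.sum_add_distrib]
  refine Finset.sum_congr rfl fun j _ => ?_
  by_cases hj : j = i
  · subst hj; simp; ring
  · simp [hj]; ring

lemma signAverage_update_zero_update (a : Fin n → ℝ) (w : Fin n → X × Y) (i : Fin n) (z : X × Y) :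
    signAverage H (Function.update a i 0) (Function.update w i z)
      = signAverage H (Function.update a i 0) w := by
  unfold signAverage weightedSup
  congr 1
  refine Finset.sum_congr rfl fun σ _ => iSup_congr fun h => Finset.sum_congr rfl fun j _ => ?_
  by_cases hj : j = i
  · subst hj; simp
  · simp [hj]

variable [MeasurableSpace X] [MeasurableSpace Y]

lemma measurable_signAverage_comp [Nonempty H] (hH : IsMeasurableClass H) {T : Type*}
    [MeasurableSpace T] {a : T → Fin n → ℝ} {w : T → Fin n → X × Y}
    (ha : ∀ i, Measurable fun t => a t i) (hw : ∀ i, Measurable fun t => w t i) :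
    Measurable fun t => signAverage H (a t) (w t) :=
  (Finset.measurable_fun_sum _ fun _ _ => measurable_weightedSup_comp hH
    (fun i => (ha i).const_mul _) hw).const_mul _

lemma rademacher_eq (hn : 0 < n) (E : ProbabilityMeasure (X × Y)) [Nonempty H]
    (hH : IsMeasurableClass H) :
    n * rademacher n H E
      = ∫ w, signAverage H (fun _ => 1) w ∂(Measure.pi fun _ : Fin n => (E : Measure (X × Y))) := by
  unfold signAverage rademacher
  rw [integral_const_mul, integral_finsetSum]
  · rw [← mul_assoc, mul_comm (n : ℝ), mul_assoc, Finset.mul_sum]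
    congr 1
    refine Finset.sum_congr rfl fun σ _ => ?_
    rw [← integral_const_mul]
    congr 1
    ext w
    rw [← Real.mul_iSup_of_nonneg (by positivity), ← mul_assoc,
      mul_one_div_cancel (by positivity), one_mul]
    simp [weightedSup]
  · intro σ _
    exact integrable_of_abs_le (measurable_weightedSup_comp hH (fun i => measurable_const)
      measurable_pi_apply) fun w => abs_weightedSup_le _ _

lemma rademacher_le_one (hn : 0 < n) (E : ProbabilityMeasure (X × Y)) [Nonempty H]
    (hH : IsMeasurableClass H) : rademacher n H E ≤ 1 := by
  have h := rademacher_eq hn E hH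
  have h2 := abs_integral_le_of_abs_le
    (μ := Measure.pi fun _ : Fin n => (E : Measure (X × Y)))
    fun w => abs_signAverage_le (H := H) (a := fun _ => 1) (by simp) w
  rw [← h] at h2
  have hn' : (0 : ℝ) < n := by positivity
  have := (abs_le.1 h2).2
  nlinarith

/-- Comparison of a weighted Rademacher complexity under `P` with the unweighted one under `E`, when
the measure with density `g` with respect to `P` is dominated by `E`. -/
lemma integral_signAverage_le [Nonempty H] (hH : IsMeasurableClass H)
    (P E : Measure (X × Y)) [IsProbabilityMeasure P] [IsProbabilityMeasure E] {g : X × Y → ℝ}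
    (hg : Measurable g) (hg0 : ∀ z, 0 ≤ g z) (hg1 : ∀ z, g z ≤ 1)
    (hle : P.withDensity (fun z => ENNReal.ofReal (g z)) ≤ E) :
    ∫ z, signAverage H (fun i => g (z i)) z ∂(Measure.pi fun _ : Fin n => P)
      ≤ ∫ w, signAverage H (fun _ => 1) w ∂(Measure.pi fun _ : Fin n => E) := by
  let I := Set.Icc (0 : ℝ) 1
  -- Carrying the weight as an extra coordinate turns the claim into a comparison of two product
  -- measures for the same F.
  let G : X × Y → (X × Y) × I := fun z => (z, ⟨g z, hg0 z, hg1 z⟩)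
  let U : X × Y → (X × Y) × I := fun z => (z, 1)
  have hG : Measurable G := measurable_id.prodMk (hg.subtype_mk)
  have hU : Measurable U := measurable_id.prodMk measurable_const
  let F : (Fin n → (X × Y) × I) → ℝ := fun v =>
    signAverage H (fun i => ((v i).2 : ℝ)) (fun i => (v i).1)
  have hF : Measurable F := measurable_signAverage_comp hH
    (fun i => measurable_subtype_coe.comp (measurable_snd.comp (measurable_pi_apply i)))
    (fun i => measurable_fst.comp (measurable_pi_apply i))
  have hFb : ∀ v, |F v| ≤ n := fun v => abs_signAverage_le
    (fun i => by rw [abs_of_nonneg (v i).2.2.1]; exact (v i).2.2.2) _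
  have := Measure.isProbabilityMeasure_map (μ := P) hG.aemeasurable
  have := Measure.isProbabilityMeasure_map (μ := E) hU.aemeasurable
  have key := integral_pi_le_integral_pi (P.map G) (E.map U) hF hFb (by
    intro v i
    let a : Fin n → ℝ := fun j => (v j).2
    let w : Fin n → X × Y := fun j => (v j).1
    have hupd : ∀ x, F (Function.update v i x)
        = signAverage H (Function.update a i x.2) (Function.update w i x.1) := by
      intro x
      simp only [F]
      congr 1 <;> ext j : 1 <;> by_cases hj : j = i
      · subst hj; simp
      · simp [hj, a]
      · subst hj; simp
      · simp [hj, w]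
    have hFu : Measurable fun x => F (Function.update v i x) := hF.comp (measurable_update v)
    rw [integral_map hG.aemeasurable hFu.aestronglyMeasurable,
      integral_map hU.aemeasurable hFu.aestronglyMeasurable]
    simp only [hupd, G, U, Set.Icc.coe_one]
    let A := signAverage H (Function.update a i 0) w
    let B : X × Y → ℝ := fun z => signAverage H (Function.update a i 1) (Function.update w i z)
    have hBm : Measurable B := by
      have := hFu.comp hU
      simpa only [Function.comp_def, hupd, U, Set.Icc.coe_one] using this
    have hBb : ∀ z, |B z| ≤ n := by
      intro z
      have := hFb (Function.update v i (U z))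
      simpa only [hupd, U, Set.Icc.coe_one] using this
    have hAB : ∀ z, A ≤ B z := by
      intro z
      have := signAverage_update_zero_le_one (H := H) a (Function.update w i z) i
      rwa [signAverage_update_zero_update] at this
    have hPi : ∀ μ : Measure (X × Y), IsFiniteMeasure μ → Integrable (fun z => B z - A) μ :=
      fun μ _ => (integrable_of_abs_le hBm hBb).sub (integrable_const _)
    have hdens : ∫ z, (B z - A) ∂(P.withDensity fun z => ENNReal.ofReal (g z))
        = ∫ z, g z * (B z - A) ∂P := by
      rw [integral_withDensity_eq_integral_toReal_smul hg.ennreal_ofReal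
        (ae_of_all _ fun z => ENNReal.ofReal_lt_top)]
      simp only [ENNReal.toReal_ofReal (hg0 _), smul_eq_mul]
    have hgB : Integrable (fun z => g z * (B z - A)) P :=
      (hPi P inferInstance).bdd_mul hg.aestronglyMeasurable (c := 1)
        (ae_of_all _ fun z => by rw [Real.norm_of_nonneg (hg0 z)]; exact hg1 z)
    -- With weight 0 the value A does not depend on z, and B ≥ A. Convexity bounds the integrand by
    -- A + g(B - A), and gP ≤ E applies because B - A ≥ 0.
    calc ∫ z, signAverage H (Function.update a i (g z)) (Function.update w i z) ∂P
        ≤ ∫ z, (A + g z * (B z - A)) ∂P := by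
          refine integral_mono ?_ ((integrable_const _).add hgB) fun z => ?_
          · have := hFu.comp hG
            simp only [Function.comp_def, hupd, G] at this
            refine integrable_of_abs_le this (M := n) fun z => ?_
            have := hFb (Function.update v i (G z))
            simpa only [hupd, G] using this
          · have := signAverage_update_le (H := H) a (Function.update w i z) i (hg0 z) (hg1 z)
            rw [signAverage_update_zero_update] at this
            refine this.trans (le_of_eq ?_)
            simp only [A, B]
            ring
      _ = A + ∫ z, (B z - A) ∂(P.withDensity fun z => ENNReal.ofReal (g z)) := by
          rw [integral_add (integrable_const _) hgB, hdens]
          simp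
      _ ≤ A + ∫ z, (B z - A) ∂E := by
          exact add_le_add le_rfl (integral_mono_measure hle
            (ae_of_all _ fun z => sub_nonneg.2 (hAB z)) (hPi E inferInstance))
      _ = ∫ z, B z ∂E := by
          rw [integral_sub (integrable_of_abs_le hBm hBb) (integrable_const _)]
          simp)
  have hGpi : Measurable fun (z : Fin n → X × Y) i => G (z i) :=
    measurable_pi_lambda _ fun i => hG.comp (measurable_pi_apply i)
  have hUpi : Measurable fun (z : Fin n → X × Y) i => U (z i) :=
    measurable_pi_lambda _ fun i => hU.comp (measurable_pi_apply i)
  rw [← Measure.pi_map_pi fun _ => hG.aemeasurable, ← Measure.pi_map_pi fun _ => hU.aemeasurable,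
    integral_map hGpi.aemeasurable hF.aestronglyMeasurable,
    integral_map hUpi.aemeasurable hF.aestronglyMeasurable] at key
  exact key

end Rademacher

/-! ### Ghost samples and symmetrization -/

section Symmetrization

variable {X Y : Type*} {H : Set (X → Y)} {n : ℕ}

/-- The signed ghost-sample supremum `sup_{h ∈ H} ∑ᵢ sᵢ (g(z'ᵢ) l(z'ᵢ, h) - g(zᵢ) l(zᵢ, h))`. -/
def ghostSup (H : Set (X → Y)) (s : Fin n → ℝ) (g : X × Y → ℝ) (z' z : Fin n → X × Y) : ℝ :=
  weightedSup H (Sum.elim (fun i => s i * g (z' i)) fun i => -(s i * g (z i))) (Sum.elim z' z)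

/-- Treating both samples as one sample of 2n points with opposite weights lets every fact about
`weightedSup` apply, measurability included. -/
lemma sum_ghost (s : Fin n → ℝ) (g : X × Y → ℝ) (z' z : Fin n → X × Y) (h : X → Y) :
    ∑ i, Sum.elim (fun i => s i * g (z' i)) (fun i => -(s i * g (z i))) i * loss (Sum.elim z' z i) h
      = ∑ i, s i * (g (z' i) * loss (z' i) h - g (z i) * loss (z i) h) := by
  rw [Fintype.sum_sum_type, ← Finset.sum_add_distrib]
  exact Finset.sum_congr rfl fun i _ => by simp only [Sum.elim_inl, Sum.elim_inr]; ring

lemma ghostSup_eq (s : Fin n → ℝ) (g : X × Y → ℝ) (z' z : Fin n → X × Y) :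
    ghostSup H s g z' z
      = ⨆ h : H, ∑ i, s i * (g (z' i) * loss (z' i) h - g (z i) * loss (z i) h) :=
  iSup_congr fun h => sum_ghost s g z' z h

lemma ghostSup_le [Nonempty H] {s : Fin n → ℝ} {g : X × Y → ℝ} {z' z : Fin n → X × Y} {r : ℝ}
    (hr : ∀ h ∈ H, ∑ i, s i * (g (z' i) * loss (z' i) h - g (z i) * loss (z i) h) ≤ r) :
    ghostSup H s g z' z ≤ r :=
  weightedSup_le fun h hh => (sum_ghost s g z' z h).trans_le (hr h hh)

lemma sum_le_ghostSup (s : Fin n → ℝ) (g : X × Y → ℝ) (z' z : Fin n → X × Y) {h : X → Y}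
    (hh : h ∈ H) : ∑ i, s i * (g (z' i) * loss (z' i) h - g (z i) * loss (z i) h)
      ≤ ghostSup H s g z' z :=
  (sum_ghost s g z' z h).symm.trans_le (sum_le_weightedSup _ _ hh)

lemma abs_ghostSup_le [Nonempty H] {s : Fin n → ℝ} (hs : ∀ i, |s i| ≤ 1) {g : X × Y → ℝ}
    (hg : ∀ z, |g z| ≤ 1) (z' z : Fin n → X × Y) : |ghostSup H s g z' z| ≤ 2 * n := by
  refine (abs_weightedSup_le _ _).trans ?_
  have h : ∀ z : Fin n → X × Y, ∑ i, |s i * g (z i)| ≤ n := by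
    intro z
    refine (Finset.sum_le_card_nsmul _ _ 1 fun i _ => ?_).trans (by simp)
    rw [abs_mul]
    exact mul_le_one₀ (hs i) (abs_nonneg _) (hg _)
  rw [Fintype.sum_sum_type]
  simp only [Sum.elim_inl, Sum.elim_inr, abs_neg]
  linarith [h z, h z']

lemma ghostSup_le_add [Nonempty H] (s : Fin n → ℝ) (g : X × Y → ℝ) (z' z : Fin n → X × Y) :
    ghostSup H s g z' z ≤ weightedSup H (fun i => s i * g (z' i)) z'
      + weightedSup H (fun i => -(s i) * g (z i)) z := by
  refine ghostSup_le fun h hh => ?_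
  refine le_trans (le_of_eq ?_) (add_le_add (sum_le_weightedSup _ z' hh)
    (sum_le_weightedSup _ z hh))
  rw [← Finset.sum_add_distrib]
  exact Finset.sum_congr rfl fun i _ => by ring

lemma ghostSup_add_le [Nonempty H] (s : Fin n → ℝ) (g₁ g₂ : X × Y → ℝ) (z' z : Fin n → X × Y) :
    ghostSup H s (fun z => g₁ z + g₂ z) z' z ≤ ghostSup H s g₁ z' z + ghostSup H s g₂ z' z := by
  refine ghostSup_le fun h hh => ?_
  refine le_trans (le_of_eq ?_) (add_le_add (sum_le_ghostSup s g₁ z' z hh)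
    (sum_le_ghostSup s g₂ z' z hh))
  rw [← Finset.sum_add_distrib]
  exact Finset.sum_congr rfl fun i _ => by ring

/-- Each term g · l lies in [0, 1], so changing one point moves every sum by at most 1. -/
lemma ghostSup_update_le [Nonempty H] {g : X × Y → ℝ} (hg0 : ∀ z, 0 ≤ g z) (hg1 : ∀ z, g z ≤ 1)
    (z' z : Fin n → X × Y) (i : Fin n) (x : X × Y) :
    ghostSup H (fun _ => 1) g z' (Function.update z i x) ≤ ghostSup H (fun _ => 1) g z' z + 1 := by
  refine ghostSup_le fun h hh => ?_
  refine le_trans ?_ (add_le_add (sum_le_ghostSup (fun _ => 1) g z' z hh)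
    (le_of_eq (Fintype.sum_ite_eq i fun _ => (1 : ℝ))))
  rw [← Finset.sum_add_distrib]
  refine Finset.sum_le_sum fun j _ => ?_
  by_cases hj : i = j
  · subst hj
    simp only [Function.update_self, if_true, one_mul]
    have h1 : g (z i) * loss (z i) h ≤ 1 :=
      mul_le_one₀ (hg1 _) (loss_nonneg _ _) (loss_le_one _ _)
    have h2 : 0 ≤ g x * loss x h := mul_nonneg (hg0 _) (loss_nonneg _ _)
    linarith
  · simp [hj, Function.update_of_ne (Ne.symm hj)]

lemma ghostSup_swap (σ : Fin n → ℤˣ) (g : X × Y → ℝ) (p : Fin n → (X × Y) × (X × Y)) :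
    ghostSup H (fun _ => 1) g (fun i => (if σ i = 1 then p i else (p i).swap).1)
        (fun i => (if σ i = 1 then p i else (p i).swap).2)
      = ghostSup H (fun i => ((σ i : ℤ) : ℝ)) g (fun i => (p i).1) (fun i => (p i).2) := by
  rw [ghostSup_eq, ghostSup_eq]
  refine iSup_congr fun h => Finset.sum_congr rfl fun i _ => ?_
  rcases Int.units_eq_one_or (σ i) with hi | hi
  · simp [hi]
  · have : (-1 : ℤˣ) ≠ 1 := by decide
    simp [hi, this]

variable [MeasurableSpace X] [MeasurableSpace Y]

lemma measurable_ghostSup_comp [Nonempty H] (hH : IsMeasurableClass H) (s : Fin n → ℝ)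
    {g : X × Y → ℝ} (hg : Measurable g) {T : Type*} [MeasurableSpace T]
    {z' z : T → Fin n → X × Y} (hz' : ∀ i, Measurable fun t => z' t i)
    (hz : ∀ i, Measurable fun t => z t i) :
    Measurable fun t => ghostSup H s g (z' t) (z t) := by
  refine measurable_weightedSup_comp hH (fun i => ?_) fun i => ?_
  · rcases i with i | i
    · exact (hg.comp (hz' i)).const_mul _
    · exact ((hg.comp (hz i)).const_mul _).neg
  · rcases i with i | i
    · exact hz' i
    · exact hz i

/-- Swapping a sample with its ghost sample in some coordinates preserves the joint law. -/
lemma measurePreserving_swap_signs (P : Measure (X × Y)) [IsProbabilityMeasure P]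
    (σ : Fin n → ℤˣ) :
    MeasurePreserving
      (fun (p : Fin n → (X × Y) × (X × Y)) i => if σ i = 1 then p i else (p i).swap)
      (Measure.pi fun _ => P.prod P) (Measure.pi fun _ => P.prod P) := by
  refine measurePreserving_pi (fun _ => P.prod P) (fun _ => P.prod P)
    (f := fun i (p : (X × Y) × (X × Y)) => if σ i = 1 then p else p.swap) fun i => ?_
  by_cases h : σ i = 1
  · simp only [h, if_true]
    exact MeasurePreserving.id (P.prod P)
  · simpa only [h, if_false] using Measure.measurePreserving_swap (μ := P) (ν := P)

/-- The symmetrization inequality. -/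
lemma integral_ghostSup_le [Nonempty H] (hH : IsMeasurableClass H) (P : Measure (X × Y))
    [IsProbabilityMeasure P] {g : X × Y → ℝ} (hg : Measurable g) (hg1 : ∀ z, |g z| ≤ 1) :
    ∫ z, ∫ z', ghostSup H (fun _ => 1) g z' z ∂(Measure.pi fun _ : Fin n => P)
        ∂(Measure.pi fun _ : Fin n => P)
      ≤ 2 * ∫ z, signAverage H (fun i => g (z i)) z ∂(Measure.pi fun _ : Fin n => P) := by
  let μ : Measure (Fin n → X × Y) := Measure.pi fun _ => P
  let ν : Measure (Fin n → (X × Y) × (X × Y)) := Measure.pi fun _ => P.prod P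
  let W : (Fin n → ℤˣ) → (Fin n → X × Y) → ℝ := fun σ z =>
    weightedSup H (fun i => ((σ i : ℤ) : ℝ) * g (z i)) z
  have hWm : ∀ σ, Measurable (W σ) := fun σ => measurable_weightedSup_comp hH
    (fun i => (hg.comp (measurable_pi_apply i)).const_mul _) measurable_pi_apply
  have hWb : ∀ σ z, |W σ z| ≤ n := by
    intro σ z
    refine (abs_weightedSup_le _ _).trans
      ((Finset.sum_le_card_nsmul _ _ 1 fun i _ => ?_).trans (by simp))
    rw [abs_mul, abs_sign, one_mul]
    exact hg1 _
  have hWi : ∀ σ, Integrable (W σ) μ := fun σ => integrable_of_abs_le (hWm σ) (hWb σ)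
  let A : (Fin n → ℝ) → (Fin n → (X × Y) × (X × Y)) → ℝ := fun s p =>
    ghostSup H s g (fun i => (p i).1) (fun i => (p i).2)
  have hAm : ∀ s, Measurable (A s) := fun s => measurable_ghostSup_comp hH s hg
    (fun i => measurable_fst.comp (measurable_pi_apply i))
    (fun i => measurable_snd.comp (measurable_pi_apply i))
  have hGm : ∀ s : Fin n → ℝ, Measurable fun q : (Fin n → X × Y) × (Fin n → X × Y) =>
      ghostSup H s g q.1 q.2 := fun s => measurable_ghostSup_comp hH s hg
    (fun i => (measurable_pi_apply i).comp measurable_fst)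
    (fun i => (measurable_pi_apply i).comp measurable_snd)
  have hprod : ∀ s : Fin n → ℝ,
      ∫ p, A s p ∂ν = ∫ q, ghostSup H s g q.1 q.2 ∂(μ.prod μ) := fun s =>
    (measurePreserving_arrowProdEquivProdArrow (X × Y) (X × Y) (Fin n) (fun _ => P)
      fun _ => P).integral_comp' fun q => ghostSup H s g q.1 q.2
  have hGi : ∀ s : Fin n → ℝ, (∀ i, |s i| ≤ 1) →
      Integrable (fun q : (Fin n → X × Y) × (Fin n → X × Y) => ghostSup H s g q.1 q.2) (μ.prod μ) :=
    fun s hs => integrable_of_abs_le (hGm s) fun q => abs_ghostSup_le hs hg1 _ _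
  have hlhs : ∫ z, ∫ z', ghostSup H (fun _ => 1) g z' z ∂μ ∂μ = ∫ p, A (fun _ => 1) p ∂ν := by
    rw [hprod, integral_prod_symm _ (hGi _ (by simp))]
  have hswap : ∀ σ : Fin n → ℤˣ,
      ∫ p, A (fun _ => 1) p ∂ν = ∫ p, A (fun i => ((σ i : ℤ) : ℝ)) p ∂ν := by
    intro σ
    have h := measurePreserving_swap_signs P σ
    conv_lhs => rw [← show _ = ν from h.map_eq]
    rw [integral_map h.measurable.aemeasurable (hAm _).aestronglyMeasurable]
    exact integral_congr_ae (ae_of_all _ fun p => ghostSup_swap σ g p)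
  -- Splitting the supremum gives one term per sample, with opposite signs; summed over all σ the
  -- two contribute equally, whence the factor 2.
  have hone : ∀ σ : Fin n → ℤˣ,
      ∫ p, A (fun _ => 1) p ∂ν ≤ ∫ z, W σ z ∂μ + ∫ z, W (-σ) z ∂μ := by
    intro σ
    rw [hswap σ, hprod]
    calc _ ≤ ∫ q, (W σ q.1 + W (-σ) q.2) ∂(μ.prod μ) := by
          refine integral_mono (hGi _ fun i => (abs_sign _).le)
            (((hWi σ).comp_fst μ).add ((hWi (-σ)).comp_snd μ)) fun q => ?_
          refine (ghostSup_le_add _ g q.1 q.2).trans (le_of_eq ?_)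
          simp [W]
      _ = _ := by
          rw [integral_add ((hWi σ).comp_fst μ) ((hWi (-σ)).comp_snd μ),
            integral_fun_fst, integral_fun_snd]
          simp
  have havg : ∫ z, signAverage H (fun i => g (z i)) z ∂μ
      = (1 / (2 : ℝ) ^ n) * ∑ σ, ∫ z, W σ z ∂μ := by
    unfold signAverage
    rw [integral_const_mul, integral_finsetSum _ fun σ _ => hWi σ]
  have hneg : ∑ σ, ∫ z, W (-σ) z ∂μ = ∑ σ, ∫ z, W σ z ∂μ :=
    Equiv.sum_comp (Equiv.neg (Fin n → ℤˣ)) fun σ => ∫ z, W σ z ∂μ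
  rw [hlhs, havg, ← sum_signs_const (n := n) (∫ p, A (fun _ => 1) p ∂ν)]
  calc _ ≤ (1 / (2 : ℝ) ^ n) * ∑ σ, (∫ z, W σ z ∂μ + ∫ z, W (-σ) z ∂μ) :=
        mul_le_mul_of_nonneg_left (Finset.sum_le_sum fun σ _ => hone σ) (by positivity)
    _ = _ := by
        rw [Finset.sum_add_distrib, hneg]
        ring

end Symmetrization

/-! ### Total variation and the overlap with extreme elements -/

section TotalVariation

variable {Ω : Type*} [MeasurableSpace Ω]

lemma abs_real_sub_real_le_one (P Q : ProbabilityMeasure Ω) (A : Set Ω) :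
    |(P : Measure Ω).real A - (Q : Measure Ω).real A| ≤ 1 := by
  have h : ∀ R : ProbabilityMeasure Ω, 0 ≤ (R : Measure Ω).real A ∧ (R : Measure Ω).real A ≤ 1 :=
    fun R => ⟨measureReal_nonneg, measureReal_le_one⟩
  rw [abs_sub_le_iff]
  constructor <;> linarith [(h P).1, (h P).2, (h Q).1, (h Q).2]

lemma abs_real_sub_real_le_tvDiam {C : Set (ProbabilityMeasure Ω)} {P Q : ProbabilityMeasure Ω}
    (hP : P ∈ C) (hQ : Q ∈ C) {A : Set Ω} (hA : MeasurableSet A) :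
    |(P : Measure Ω).real A - (Q : Measure Ω).real A| ≤ tvDiam C := by
  have h1 : |(P : Measure Ω).real A - (Q : Measure Ω).real A| ≤ tvDist P Q :=
    le_ciSup (f := fun A : {A : Set Ω // MeasurableSet A} =>
      |(P : Measure Ω).real A.1 - (Q : Measure Ω).real A.1|)
      ⟨1, by rintro _ ⟨A, rfl⟩; exact abs_real_sub_real_le_one P Q A.1⟩ ⟨A, hA⟩
  have h2 : tvDist P Q ≤ tvDiam C := by
    refine le_ciSup (f := fun p : C × C => tvDist p.1.1 p.2.1) ⟨1, ?_⟩ (⟨P, hP⟩, ⟨Q, hQ⟩)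
    rintro _ ⟨p, rfl⟩
    have : Nonempty {A : Set Ω // MeasurableSet A} := ⟨∅, MeasurableSet.empty⟩
    exact ciSup_le fun A => abs_real_sub_real_le_one _ _ A.1
  exact h1.trans h2

/-- P(D) + Q(Dᶜ) = 1 - (Q(D) - P(D)). -/
lemma ofReal_one_sub_tvDiam_le {C : Set (ProbabilityMeasure Ω)} {P Q : ProbabilityMeasure Ω}
    (hP : P ∈ C) (hQ : Q ∈ C) {D : Set Ω} (hD : MeasurableSet D) :
    ENNReal.ofReal (1 - tvDiam C) ≤ (P : Measure Ω) D + (Q : Measure Ω) Dᶜ := by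
  have h := (abs_sub_le_iff.1 (abs_real_sub_real_le_tvDiam hP hQ hD)).2
  have hc : (Q : Measure Ω).real Dᶜ = 1 - (Q : Measure Ω).real D := probReal_compl_eq_one_sub hD
  rw [← ofReal_measureReal (measure_ne_top _ _), ← ofReal_measureReal (measure_ne_top _ _),
    ← ENNReal.ofReal_add measureReal_nonneg measureReal_nonneg]
  exact ENNReal.ofReal_le_ofReal (by linarith)

lemma le_restrict_of_le {m μ ν : Measure Ω} {B : Set Ω} (hB : MeasurableSet B) (hm : m ≤ μ)
    (hmB : m Bᶜ = 0) (h : ∀ t, MeasurableSet t → t ⊆ B → μ t ≤ ν t) : m ≤ ν.restrict B := by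
  rw [← Measure.restrict_eq_self_of_ae_mem (mem_ae_iff.2 hmB : ∀ᵐ x ∂m, x ∈ B)]
  exact (Measure.restrict_mono le_rfl hm).trans (restrict_le_restrict_of_forall_subset hB h)

lemma withDensity_indicator_eq {m P : Measure Ω} {g : Ω → ℝ} {B : Set Ω} (hB : MeasurableSet B)
    (hm : m = P.withDensity fun z => ENNReal.ofReal (g z)) (hmB : m Bᶜ = 0) :
    P.withDensity (fun z => ENNReal.ofReal (B.indicator g z)) = m := by
  have e : (fun z => ENNReal.ofReal (B.indicator g z))
      = B.indicator fun z => ENNReal.ofReal (g z) := by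
    ext z
    by_cases hz : z ∈ B <;> simp [hz]
  rw [e, withDensity_indicator hB, ← restrict_withDensity hB, ← hm]
  exact Measure.restrict_eq_self_of_ae_mem (mem_ae_iff.2 hmB)

/-- Any two elements `P`, `Q` of a closed set of probability measures have a common part of mass at
least `1 - tvDiam C` that splits into two pieces, each dominated by an extreme element. -/
lemma exists_extreme_overlap [TopologicalSpace Ω] [PolishSpace Ω] [BorelSpace Ω]
    {C : Set (ProbabilityMeasure Ω)} (hC : IsClosed C) {P Q : ProbabilityMeasure Ω} (hP : P ∈ C)
    (hQ : Q ∈ C) :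
    ∃ E ∈ extremeElements C, ∃ E' ∈ extremeElements C, ∃ g g' : Ω → ℝ,
      Measurable g ∧ Measurable g' ∧ (∀ z, 0 ≤ g z) ∧ (∀ z, 0 ≤ g' z) ∧ (∀ z, g z + g' z ≤ 1) ∧
      (P : Measure Ω).withDensity (fun z => ENNReal.ofReal (g z)) ≤ E ∧
      (P : Measure Ω).withDensity (fun z => ENNReal.ofReal (g' z)) ≤ E' ∧
      (P : Measure Ω).withDensity (fun z => ENNReal.ofReal (g z + g' z)) ≤ Q ∧
      1 - tvDiam C ≤ ∫ z, (g z + g' z) ∂(P : Measure Ω) := by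
  obtain ⟨T, _, π, κ, hπ, hκ, hκC, hPκ⟩ := exists_mixture_extremeElements hC hP
  obtain ⟨T', _, ρ, κ', hρ, hκ', hκC', hQκ⟩ := exists_mixture_extremeElements hC hQ
  obtain ⟨B, hB, hB1, hB2⟩ := hahn_decomposition (P : Measure Ω) (Q : Measure Ω)
  have hex : ∀ E ∈ extremeElements C, E ∈ C := by
    intro E hE
    obtain ⟨E₀, hE₀, he⟩ := hE.1
    exact ProbabilityMeasure.toMeasure_injective he ▸ hE₀
  obtain ⟨_, ⟨E, hE, rfl⟩, _, ⟨E', hE', rfl⟩, m, m', hmE, hmQ, hmB, hmE', hmP', hmB', hmass⟩ :=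
    exists_overlap_of_mixture (S := (fun E : ProbabilityMeasure Ω => (E : Measure Ω)) ''
      extremeElements C) (c := ENNReal.ofReal (1 - tvDiam C))
      (by rintro _ ⟨E, -, rfl⟩; infer_instance)
      (by
        rintro _ ⟨E, hE, rfl⟩ _ ⟨E', hE', rfl⟩ D hD
        exact ofReal_one_sub_tvDiam_le (hex E hE) (hex E' hE') hD)
      hκ hκ' (hκC.mono fun t ⟨E, hE, h⟩ => ⟨E, hE, h.symm⟩)
      (hκC'.mono fun t ⟨E, hE, h⟩ => ⟨E, hE, h.symm⟩) hPκ hQκ hB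
  -- On B one has Q ≤ P, so m ≤ Q gives m ≤ P; off B the roles are exchanged for m'. As the pieces
  -- live on disjoint sets, their sum stays below both P and Q.
  have hmP : m ≤ (P : Measure Ω).restrict B := le_restrict_of_le hB hmQ hmB hB1
  have hmQr : m ≤ (Q : Measure Ω).restrict B :=
    le_restrict_of_le hB hmQ hmB fun _ _ _ => le_rfl
  have hmQ' : m' ≤ (Q : Measure Ω).restrict Bᶜ :=
    le_restrict_of_le hB.compl hmP' (by simpa using hmB') hB2
  obtain ⟨f, hfm, hf0, hf1, hf⟩ := exists_density_unitInterval (hmP.trans Measure.restrict_le_self)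
  obtain ⟨f', hfm', hf0', hf1', hf'⟩ := exists_density_unitInterval hmP'
  have hd := withDensity_indicator_eq hB hf hmB
  have hd' := withDensity_indicator_eq hB.compl hf' (by simpa using hmB')
  have h0 : ∀ z, 0 ≤ B.indicator f z := Set.indicator_nonneg fun z _ => hf0 z
  have h0' : ∀ z, 0 ≤ Bᶜ.indicator f' z := Set.indicator_nonneg fun z _ => hf0' z
  have h1 : ∀ z, B.indicator f z + Bᶜ.indicator f' z ≤ 1 := by
    intro z
    by_cases hz : z ∈ B
    · simpa [hz] using hf1 z
    · simpa [hz] using hf1' z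
  have hsum : (P : Measure Ω).withDensity
      (fun z => ENNReal.ofReal (B.indicator f z + Bᶜ.indicator f' z)) = m + m' := by
    rw [← hd, ← hd', ← withDensity_add_left (hfm.indicator hB).ennreal_ofReal]
    congr 1
    ext z
    exact ENNReal.ofReal_add (h0 z) (h0' z)
  refine ⟨E, hE, E', hE', B.indicator f, Bᶜ.indicator f', hfm.indicator hB,
    hfm'.indicator hB.compl, h0, h0', h1, hd.trans_le hmE, hd'.trans_le hmE', ?_, ?_⟩
  · rw [hsum]
    exact (add_le_add hmQr hmQ').trans (Measure.restrict_add_restrict_compl hB).le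
  · rw [integral_eq_lintegral_of_nonneg_ae (ae_of_all _ fun z => add_nonneg (h0 z) (h0' z))
      ((hfm.indicator hB).add (hfm'.indicator hB.compl)).aestronglyMeasurable]
    have hu : ∫⁻ z, ENNReal.ofReal (B.indicator f z + Bᶜ.indicator f' z) ∂(P : Measure Ω)
        = m Set.univ + m' Set.univ := by
      rw [← setLIntegral_univ, ← withDensity_apply _ MeasurableSet.univ, hsum]
      rfl
    rw [hu]
    refine (ENNReal.ofReal_le_iff_le_toReal ?_).1 hmass
    exact ENNReal.add_ne_top.2
      ⟨ne_top_of_le_ne_top (measure_ne_top (Q : Measure Ω) Set.univ) (hmQ _),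
        ne_top_of_le_ne_top (measure_ne_top (P : Measure Ω) Set.univ) (hmP' _)⟩

end TotalVariation

/-! ### Risk bounds from the overlap and the ghost sample -/

section RiskBound

variable {X Y : Type*} [MeasurableSpace X] [MeasurableSpace Y]

lemma measurable_loss [MeasurableEq Y] {h : X → Y} (hh : Measurable h) :
    Measurable fun z : X × Y => loss z h := by
  unfold loss
  exact Measurable.ite (measurableSet_eq_fun measurable_snd (hh.comp measurable_fst)).compl
    measurable_const measurable_const

/-- Testing gP ≤ Q on 1 - l ≥ 0 gives ∫ g(1 - l) dP ≤ 1 - L_Q(h); the mass of P not covered by g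
costs at most η. -/
lemma risk_le_of_overlap {P Q : ProbabilityMeasure (X × Y)} {g : X × Y → ℝ} (hg : Measurable g)
    (hg0 : ∀ z, 0 ≤ g z) (hg1 : ∀ z, g z ≤ 1) {η : ℝ}
    (hle : (P : Measure (X × Y)).withDensity (fun z => ENNReal.ofReal (g z)) ≤ Q)
    (hmass : 1 - η ≤ ∫ z, g z ∂(P : Measure (X × Y))) {h : X → Y}
    (hm : Measurable fun z : X × Y => loss z h) :
    risk Q h ≤ η + ∫ z, g z * loss z h ∂(P : Measure (X × Y)) := by
  have hgi : Integrable g (P : Measure (X × Y)) :=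
    integrable_of_abs_le hg (M := 1) fun z => by rw [abs_of_nonneg (hg0 z)]; exact hg1 z
  have hli : ∀ R : ProbabilityMeasure (X × Y), Integrable (fun z => loss z h) (R : Measure (X × Y)) :=
    fun R => integrable_of_abs_le hm fun z => abs_loss_le_one z h
  have hgli : Integrable (fun z => g z * loss z h) (P : Measure (X × Y)) :=
    (hli P).bdd_mul hg.aestronglyMeasurable (c := 1)
      (ae_of_all _ fun z => by rw [Real.norm_of_nonneg (hg0 z)]; exact hg1 z)
  have h1 := integral_mono_measure hle
    (ae_of_all _ fun z => sub_nonneg.2 (loss_le_one z h)) ((integrable_const 1).sub (hli Q))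
  rw [integral_withDensity_eq_integral_toReal_smul hg.ennreal_ofReal
    (ae_of_all _ fun z => ENNReal.ofReal_lt_top), integral_sub (integrable_const _) (hli Q)] at h1
  simp only [ENNReal.toReal_ofReal (hg0 _), smul_eq_mul, mul_sub, mul_one] at h1
  rw [integral_sub hgi hgli] at h1
  simp only [integral_const, probReal_univ, smul_eq_mul, mul_one] at h1
  unfold risk
  linarith

/-- The expected ghost-sample supremum, as a function of the sample. -/
def ghostMean {n : ℕ} (H : Set (X → Y)) (P : ProbabilityMeasure (X × Y)) (g : X × Y → ℝ)
    (z : Fin n → X × Y) : ℝ :=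
  ∫ z', ghostSup H (fun _ => 1) g z' z ∂(Measure.pi fun _ : Fin n => (P : Measure (X × Y)))

variable {H : Set (X → Y)} {n : ℕ} {P : ProbabilityMeasure (X × Y)}

lemma integrable_ghostSup_left [Nonempty H] (hH : IsMeasurableClass H) {g : X × Y → ℝ}
    (hg : Measurable g) (hgb : ∀ z, |g z| ≤ 1) (z : Fin n → X × Y) :
    Integrable (fun z' => ghostSup H (fun _ => 1) g z' z)
      (Measure.pi fun _ : Fin n => (P : Measure (X × Y))) :=
  integrable_of_abs_le
    (measurable_ghostSup_comp hH _ hg measurable_pi_apply fun _ => measurable_const)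
    fun z' => abs_ghostSup_le (by simp) hgb z' z

lemma measurable_ghostMean [Nonempty H] (hH : IsMeasurableClass H) {g : X × Y → ℝ}
    (hg : Measurable g) : Measurable (ghostMean (n := n) H P g) := by
  have : Measurable fun q : (Fin n → X × Y) × (Fin n → X × Y) =>
      ghostSup H (fun _ => 1) g q.2 q.1 :=
    measurable_ghostSup_comp hH _ hg (fun i => (measurable_pi_apply i).comp measurable_snd)
      fun i => (measurable_pi_apply i).comp measurable_fst
  exact this.stronglyMeasurable.integral_prod_right'.measurable

lemma abs_ghostMean_le [Nonempty H] {g : X × Y → ℝ} (hgb : ∀ z, |g z| ≤ 1) (z : Fin n → X × Y) :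
    |ghostMean H P g z| ≤ 2 * n :=
  abs_integral_le_of_abs_le fun z' => abs_ghostSup_le (by simp) hgb z' z

lemma integral_sum_eval {f : X × Y → ℝ} (hf : Integrable f (P : Measure (X × Y))) :
    ∫ z, ∑ i, f (z i) ∂(Measure.pi fun _ : Fin n => (P : Measure (X × Y)))
      = n * ∫ z, f z ∂(P : Measure (X × Y)) := by
  rw [integral_finsetSum _ fun i _ => integrable_comp_eval
    (μ := fun _ : Fin n => (P : Measure (X × Y))) (i := i) hf]
  simp [integral_comp_eval (μ := fun _ : Fin n => (P : Measure (X × Y))) hf.aestronglyMeasurable]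

/-- The ghost sum has mean n ∫ g l dP. On the actual sample g ≤ 1 allows the unweighted loss, the
one that the empirical minimizer controls. -/
lemma mul_integral_le_add_ghostMean [Nonempty H] (hH : IsMeasurableClass H) {g : X × Y → ℝ}
    (hg : Measurable g) (hg0 : ∀ z, 0 ≤ g z) (hg1 : ∀ z, g z ≤ 1) {h : X → Y} (hh : h ∈ H)
    (hm : Measurable fun z : X × Y => loss z h) (z : Fin n → X × Y) :
    n * ∫ x, g x * loss x h ∂(P : Measure (X × Y)) ≤ ∑ i, loss (z i) h + ghostMean H P g z := by
  have hgb : ∀ z, |g z| ≤ 1 := fun z => by rw [abs_of_nonneg (hg0 z)]; exact hg1 z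
  have hgl : Integrable (fun x => g x * loss x h) (P : Measure (X × Y)) :=
    integrable_of_abs_le (hg.mul hm) (M := 1) fun z => by
      rw [abs_mul]
      exact mul_le_one₀ (hgb z) (abs_nonneg _) (abs_loss_le_one z h)
  have hs : Integrable (fun z' : Fin n → X × Y => ∑ i, g (z' i) * loss (z' i) h)
      (Measure.pi fun _ : Fin n => (P : Measure (X × Y))) :=
    integrable_finsetSum _ fun i _ => integrable_comp_eval
      (μ := fun _ : Fin n => (P : Measure (X × Y))) (i := i) hgl
  have hle : ∑ i, g (z i) * loss (z i) h ≤ ∑ i, loss (z i) h :=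
    Finset.sum_le_sum fun i _ => mul_le_of_le_one_left (loss_nonneg _ _) (hg1 _)
  have key : ∫ z', (∑ i, g (z' i) * loss (z' i) h - ∑ i, g (z i) * loss (z i) h)
      ∂(Measure.pi fun _ : Fin n => (P : Measure (X × Y))) ≤ ghostMean H P g z := by
    refine integral_mono (hs.sub (integrable_const _))
      (integrable_ghostSup_left hH hg hgb z) fun z' => ?_
    have := sum_le_ghostSup (fun _ => 1) g z' z hh
    simpa only [one_mul, Finset.sum_sub_distrib] using this
  rw [integral_sub hs (integrable_const _), integral_sum_eval hgl] at key
  simp only [integral_const, probReal_univ, smul_eq_mul, one_mul] at key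
  linarith

/-- The ghost supremum is subadditive in the weight, so g and g' are symmetrized separately, each
against its own extreme element. -/
lemma integral_ghostMean_add_le [Nonempty H] (hH : IsMeasurableClass H) (hn : 0 < n)
    {E E' : ProbabilityMeasure (X × Y)} {g g' : X × Y → ℝ} (hg : Measurable g)
    (hg' : Measurable g') (hg0 : ∀ z, 0 ≤ g z) (hg0' : ∀ z, 0 ≤ g' z) (hgg' : ∀ z, g z + g' z ≤ 1)
    (hE : (P : Measure (X × Y)).withDensity (fun z => ENNReal.ofReal (g z)) ≤ E)
    (hE' : (P : Measure (X × Y)).withDensity (fun z => ENNReal.ofReal (g' z)) ≤ E') :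
    ∫ z, ghostMean H P (fun z => g z + g' z) z
        ∂(Measure.pi fun _ : Fin n => (P : Measure (X × Y)))
      ≤ n * (2 * rademacher n H E + 2 * rademacher n H E') := by
  have h1 : ∀ z, g z ≤ 1 := fun z => by linarith [hgg' z, hg0' z]
  have h1' : ∀ z, g' z ≤ 1 := fun z => by linarith [hgg' z, hg0 z]
  have hb : ∀ z, |g z| ≤ 1 := fun z => by rw [abs_of_nonneg (hg0 z)]; exact h1 z
  have hb' : ∀ z, |g' z| ≤ 1 := fun z => by rw [abs_of_nonneg (hg0' z)]; exact h1' z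
  have hbs : ∀ z, |g z + g' z| ≤ 1 := fun z => by
    rw [abs_of_nonneg (add_nonneg (hg0 z) (hg0' z))]; exact hgg' z
  have hint : ∀ {f : X × Y → ℝ}, Measurable f → (∀ z, |f z| ≤ 1) →
      Integrable (ghostMean H P f) (Measure.pi fun _ : Fin n => (P : Measure (X × Y))) :=
    fun hf hfb => integrable_of_abs_le (measurable_ghostMean hH hf) (abs_ghostMean_le hfb)
  have e1 := (integral_ghostSup_le (n := n) hH (P : Measure (X × Y)) hg hb).trans
    (mul_le_mul_of_nonneg_left (integral_signAverage_le hH P E hg hg0 h1 hE) zero_le_two)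
  have e2 := (integral_ghostSup_le (n := n) hH (P : Measure (X × Y)) hg' hb').trans
    (mul_le_mul_of_nonneg_left (integral_signAverage_le hH P E' hg' hg0' h1' hE') zero_le_two)
  rw [← rademacher_eq hn _ hH] at e1 e2
  calc _ ≤ ∫ z, (ghostMean H P g z + ghostMean H P g' z)
        ∂(Measure.pi fun _ : Fin n => (P : Measure (X × Y))) := by
        refine integral_mono (hint (hg.add hg') hbs) ((hint hg hb).add (hint hg' hb')) fun z => ?_
        simp only [ghostMean]
        rw [← integral_add (integrable_ghostSup_left hH hg hb z)
          (integrable_ghostSup_left hH hg' hb' z)]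
        exact integral_mono (integrable_ghostSup_left hH (hg.add hg') hbs z)
          ((integrable_ghostSup_left hH hg hb z).add (integrable_ghostSup_left hH hg' hb' z))
          fun z' => ghostSup_add_le _ g g' z' z
    _ = ∫ z, ghostMean H P g z ∂(Measure.pi fun _ : Fin n => (P : Measure (X × Y)))
        + ∫ z, ghostMean H P g' z ∂(Measure.pi fun _ : Fin n => (P : Measure (X × Y))) :=
        integral_add (hint hg hb) (hint hg' hb')
    _ ≤ _ := by
        refine (add_le_add e1 e2).trans (le_of_eq ?_)
        ring

lemma ghostMean_update_le [Nonempty H] (hH : IsMeasurableClass H) {g : X × Y → ℝ}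
    (hg : Measurable g) (hg0 : ∀ z, 0 ≤ g z) (hg1 : ∀ z, g z ≤ 1) (z : Fin n → X × Y) (i : Fin n)
    (x : X × Y) : ghostMean H P g (Function.update z i x) ≤ ghostMean H P g z + 1 := by
  have hgb : ∀ z, |g z| ≤ 1 := fun z => by rw [abs_of_nonneg (hg0 z)]; exact hg1 z
  have hi := fun z : Fin n → X × Y => integrable_ghostSup_left (P := P) hH hg hgb z
  have := integral_mono (hi (Function.update z i x)) ((hi z).add (integrable_const 1))
    fun z' => ghostSup_update_le hg0 hg1 z' z i x
  rw [integral_add' (hi z) (integrable_const 1)] at this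
  simpa [ghostMean] using this

omit [MeasurableSpace X] [MeasurableSpace Y] in
lemma sum_loss_update_le (z : Fin n → X × Y) (i : Fin n) (x : X × Y) (h : X → Y) :
    ∑ j, loss (Function.update z i x j) h ≤ ∑ j, loss (z j) h + 1 := by
  rw [← Fintype.sum_ite_eq i fun _ => (1 : ℝ), ← Finset.sum_add_distrib]
  refine Finset.sum_le_sum fun j _ => ?_
  by_cases hj : i = j
  · subst hj
    simpa using (loss_le_one x h).trans (le_add_of_nonneg_left (loss_nonneg (z i) h))
  · simp [hj, Function.update_of_ne (Ne.symm hj)]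

end RiskBound

end CredalLearning

end

/-! ### The generalization bound -/

open CredalLearning in
theorem mainTheorem8
    {X Y : Type*}
    [TopologicalSpace X] [PolishSpace X] [MeasurableSpace X] [BorelSpace X]
    [TopologicalSpace Y] [PolishSpace Y] [MeasurableSpace Y] [BorelSpace Y]
    (H : Set (X → Y)) (hHmeas : ∀ h ∈ H, Measurable h)
    (hHclass : CredalLearning.IsMeasurableClass H)
    (C : Set (ProbabilityMeasure (X × Y))) (hC : CredalLearning.IsCredalSet C)
    (P Q : ProbabilityMeasure (X × Y)) (hP : P ∈ C) (hQ : Q ∈ C) (hQP : Q ≠ P)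
    (η : ℝ) (hη : 0 < η) (hdiam : CredalLearning.tvDiam C = η)
    (δ : ℝ) (hδ : δ ∈ Set.Ioo (0 : ℝ) 1)
    (n : ℕ) (hn : 0 < n)
    {S : Type*} [MeasurableSpace S] (μ : Measure S) [IsProbabilityMeasure μ]
    (Z : Fin n → S → X × Y) (hZindep : iIndepFun Z μ)
    (hZlaw : ∀ i, HasLaw (Z i) (P : Measure (X × Y)) μ)
    (hstar : X → Y) (hhstar : CredalLearning.IsRiskMin H P hstar)
    (hhat : S → X → Y) (hhhat : ∀ s, CredalLearning.IsERM H (fun i => Z i s) (hhat s)) :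
    ∃ G : Set S, MeasurableSet G ∧
      G ⊆ {s | CredalLearning.risk Q (hhat s) - CredalLearning.risk P hstar
                ≤ CredalLearning.epsBound n H C δ + η} ∧
      1 - δ ≤ μ.real G := by
  have : Nonempty H := ⟨⟨hstar, hhstar.1⟩⟩
  obtain ⟨E, hE, E', hE', g, g', hg, hg', hg0, hg0', hgg', hdE, hdE', hdQ, hmass⟩ :=
    exists_extreme_overlap hC.closed hP hQ
  rw [hdiam] at hmass
  have hn' : (0 : ℝ) < n := Nat.cast_pos.2 hn
  let f : X × Y → ℝ := fun z => g z + g' z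
  have hf : Measurable f := hg.add hg'
  have hf0 : ∀ z, 0 ≤ f z := fun z => add_nonneg (hg0 z) (hg0' z)
  have hfb : ∀ z, |f z| ≤ 1 := fun z => by rw [abs_of_nonneg (hf0 z)]; exact hgg' z
  have hloss : ∀ h ∈ H, Measurable fun z : X × Y => loss z h := fun h hh =>
    measurable_loss (hHmeas h hh)
  let L : (Fin n → X × Y) → ℝ := fun z => ∑ i, loss (z i) hstar
  have hLm : Measurable L := Finset.measurable_fun_sum _ fun i _ =>
    (hloss _ hhstar.1).comp (measurable_pi_apply i)
  have hLb : ∀ z, |L z| ≤ n := fun z => by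
    simpa [L] using abs_sum_mul_loss_le (fun _ => 1) z hstar
  -- Ψ involves h⋆ but not ĥ, so a single concentration bound covers both the empirical risk of h⋆
  -- and the uniform deviation; each of the two moves by at most 1/n per coordinate.
  let Ψ : (Fin n → X × Y) → ℝ := fun z => (1 / (n : ℝ)) * (L z + ghostMean H P f z)
  have hΨm : Measurable Ψ := (hLm.add (measurable_ghostMean hHclass hf)).const_mul _
  have hΨb : ∀ z, |Ψ z| ≤ (1 / (n : ℝ)) * (n + 2 * n) := fun z => by
    rw [abs_mul, abs_of_pos (by positivity)]
    exact mul_le_mul_of_nonneg_left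
      ((abs_add_le _ _).trans (add_le_add (hLb z) (abs_ghostMean_le hfb z))) (by positivity)
  have hΨd : ∀ z i x, Ψ (Function.update z i x) ≤ Ψ z + 2 / n := fun z i x => by
    have h1 := sum_loss_update_le z i x hstar
    have h2 := ghostMean_update_le (P := P) hHclass hf hf0 hgg' z i x
    have e : Ψ z + 2 / n = (1 / (n : ℝ)) * (L z + ghostMean H P f z + 2) := by
      simp only [Ψ]; ring
    rw [e]
    refine mul_le_mul_of_nonneg_left ?_ (by positivity)
    simp only [L]
    linarith
  let m : Measure (Fin n → X × Y) := Measure.pi fun _ => (P : Measure (X × Y))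
  -- A real supremum of an unbounded family is 0 by convention, so the uniform bound 1 is needed
  -- here.
  have hrad : ∀ F ∈ extremeElements C, rademacher n H F ≤ upperRademacher n H C := fun F hF =>
    le_ciSup (f := fun F : extremeElements C => rademacher n H F.1)
      ⟨1, by rintro _ ⟨F, rfl⟩; exact rademacher_le_one hn F.1 hHclass⟩ ⟨F, hF⟩
  have hmean : ∫ z, Ψ z ∂m ≤ risk P hstar + 4 * upperRademacher n H C := by
    have h1 := integral_ghostMean_add_le hHclass hn hg hg' hg0 hg0' hgg' hdE hdE'
    have h2 : ∫ z, L z ∂m = n * risk P hstar := integral_sum_eval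
      (integrable_of_abs_le (hloss _ hhstar.1) fun z => abs_loss_le_one z hstar)
    have h3 : ∫ z, Ψ z ∂m = (1 / (n : ℝ)) * (∫ z, L z ∂m + ∫ z, ghostMean H P f z ∂m) := by
      rw [← integral_add (integrable_of_abs_le hLm hLb)
        (integrable_of_abs_le (measurable_ghostMean hHclass hf) (abs_ghostMean_le hfb)),
        ← integral_const_mul]
    rw [h3, h2, one_div_mul_eq_div, div_le_iff₀ hn']
    have h4 := mul_le_mul_of_nonneg_left (add_le_add (hrad E hE) (hrad E' hE')) hn'.le
    have h5 : ∫ z, ghostMean H P f z ∂m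
      ≤ n * (2 * rademacher n H E + 2 * rademacher n H E') := h1
    linarith
  have hdet : ∀ s, risk Q (hhat s) ≤ η + Ψ fun i => Z i s := fun s => by
    have hs := hhhat s
    have h1 := risk_le_of_overlap hf hf0 hgg' hdQ hmass (hloss _ hs.1)
    have h2 := mul_integral_le_add_ghostMean (P := P) hHclass hf hf0 hgg' hs.1 (hloss _ hs.1)
      fun i => Z i s
    have h3 := hs.2 _ hhstar.1
    have h4 : ∑ i, loss (Z i s) (hhat s) ≤ L fun i => Z i s :=
      le_of_mul_le_mul_left h3 (by positivity)
    refine h1.trans (add_le_add le_rfl ?_)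
    simp only [Ψ]
    rw [one_div_mul_eq_div, le_div_iff₀ hn', mul_comm]
    linarith
  let t : ℝ := √(2 * Real.log (2 / δ) / n)
  have hlog : 0 ≤ Real.log (2 / δ) :=
    Real.log_nonneg ((one_le_div hδ.1).2 (by linarith [hδ.2]))
  have htail : m.real {z | t ≤ Ψ z - ∫ v, Ψ v ∂m} ≤ δ := by
    refine (measure_ge_le_of_bounded_differences (P : Measure (X × Y)) (by positivity) hΨm hΨb hΨd
      (Real.sqrt_nonneg _)).trans ?_
    rw [Real.sq_sqrt (by positivity)]
    -- With c = 2/n, McDiarmid's exponent is -t²n/2 = -log(2/δ), so the tail is at most δ/2.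
    have e : -(2 * Real.log (2 / δ) / n) / (2 * (n * (2 / (n : ℝ)) ^ 2 / 4))
        = -Real.log (2 / δ) := by
      field_simp
      ring
    rw [e, Real.exp_neg, Real.exp_log (div_pos two_pos hδ.1), inv_div]
    linarith [hδ.1]
  have hZae : ∀ i, AEMeasurable (Z i) μ := fun i => (hZlaw i).aemeasurable
  have hZpi : AEMeasurable (fun s i => Z i s) μ := aemeasurable_pi_lambda _ hZae
  have hmap : μ.map (fun s i => Z i s) = m := by
    rw [(iIndepFun_iff_map_fun_eq_pi_map hZae).1 hZindep]
    simp only [m, (hZlaw _).map_eq]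
  have hbad : MeasurableSet {z | t ≤ Ψ z - ∫ v, Ψ v ∂m} :=
    measurableSet_le measurable_const (hΨm.sub_const _)
  -- The good event is expressed through Ψ because ĥ need not be measurable in s. The sample is only
  -- almost everywhere measurable, so the preimage is null-measurable and is shrunk to a measurable
  -- set.
  obtain ⟨G, hGsub, hGm, hGae⟩ :=
    (hZpi.nullMeasurableSet_preimage hbad.compl).exists_measurable_subset_ae_eq
  refine ⟨G, hGm, fun s hs => ?_, ?_⟩
  · have hs' : ¬ t ≤ Ψ (fun i => Z i s) - ∫ v, Ψ v ∂m := hGsub hs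
    have h1 := hdet s
    have h2 : epsBound n H C δ = 4 * upperRademacher n H C + t := rfl
    change risk Q (hhat s) - risk P hstar ≤ epsBound n H C δ + η
    rw [h2]
    linarith [not_le.1 hs']
  · rw [measureReal_congr hGae, measureReal_def, ← Measure.map_apply_of_aemeasurable hZpi hbad.compl,
      hmap, ← measureReal_def, probReal_compl_eq_one_sub hbad]
    linarith
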